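/- **Setting.** A database has a finite set $\mathsf{Keys}$ of keys and a set of rows, each row having a key. A *history* $h=\langle T,\mathsf{so},\mathsf{wr}\rangle$ consists of a finite set $T$ of transactions, each with an isolation level in $\{\mathrm{SER},\mathrm{SI},\mathrm{PC},\mathrm{RA},\mathrm{RC}\}$; a finite set of events (begin, commit, abort, $\mathrm{SELECT}(p)$, $\mathrm{INSERT}(R)$, $\mathrm{DELETE}(p)$, $\mathrm{UPDATE}(p,U)$), each belonging to one transaction $\mathsf{tr}(e)$ and totally ordered inside it by $\mathsf{po}$, a begin first, a commit or abort last; a strict partial order $\mathsf{so}$ on $T$; and, for every key $x$, a relation $\mathsf{wr}_x$ from write events (INSERT, DELETE, UPDATE of non-aborted transactions) to read events (SELECT, DELETE, UPDATE) whose inverse $\mathsf{wr}_x^{-1}$ is a partial function, such that $\mathsf{so}\cup\mathsf{wr}$ is acyclic and $(w,r)\in\mathsf{wr}_x$ implies $\mathrm{value}(w,x)\ne\bot$. Here $\mathrm{value}(w,x)$ is the inserted row with key $x$ for an INSERT; it is $\dagger_x$ (deleted) for $\mathrm{DELETE}(p)$, resp. $U(x)$ for $\mathrm{UPDATE}(p,U)$,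 if $w$ reads from some $w'=\mathsf{wr}_x^{-1}(w)$ whose value for $x$ satisfies $p$; otherwise it is $\bot$; $\dagger_x,\bot$ satisfy no predicate. A non-aborted transaction *writes* $x$ if one of its events has a value $\ne\bot$ for $x$, and its value is that of its last such event. A distinguished non-aborted transaction precedes all others in $\mathsf{so}$, inserts a row (or $\dagger_x$) for every key $x$, and is the only one that may insert $\dagger_x$. A history is *full* if every read event reads every key, except keys written earlier in its own transaction; $h$ is a *client history* if some full history $\langle T,\mathsf{so},\overline{\mathsf{wr}}\rangle$ with $\mathsf{wr}\subseteq\overline{\mathsf{wr}}$ is such that, for every $(w,r)\in\overline{\mathsf{wr}}_x\setminus\mathsf{wr}_x$, the value of $w$ for $x$ does not satisfy the predicate of $r$. **Visibility.** For a relation $R$ on $T$, a transaction $t_2$ and a read $r$: Read Committed, $t_2$ is related by $\mathsf{so}\cup\mathsf{wr}$ to $r$ or to an event before $r$ in $\mathsf{tr}(r)$; Read Atomic, $(t_2,\mathsf{tr}(r))\in\mathsf{so}\cup\mathsf{wr}$; Serializability, $(t_2,\mathsf{tr}(r))\in R$; Prefix, $(t_2,\mathsf{tr}(r))\in R^*;(\mathsf{so}\cup\mathsf{wr})$;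 Conflict, there are $t_4$ and a key $y$ written by $t_4$ and by $\mathsf{tr}(r)$ with $(t_2,t_4)\in R^*$, $(t_4,\mathsf{tr}(r))\in R$. RC, RA, SER, PC use the first, second, third, fourth of these, SI uses Prefix and Conflict. $\mathrm{saturate}(h,R)$ adds to $R$ all pairs $(t_2,t_1)$ such that, for some key $x$ and read $r$, $r$ reads $x$ from $t_1$, $t_2\notin\{t_1,\mathsf{tr}(r)\}$ writes $x$, and $t_2$ is visible to $r$ (with $R$) by a visibility relation of the isolation level of $\mathsf{tr}(r)$. $\mathsf{pco}$ is the least fixpoint of $\mathrm{saturate}(h,\cdot)$ above $(\mathsf{so}\cup\mathsf{wr})^+$. For a read $r$ and a key $x$, $1_x^r$ (resp. $0_x^r$) is the set of transactions $t$ with $(\mathsf{tr}(r),t)\notin\mathsf{pco}$ that write $x$ with a value that satisfies (resp. does not satisfy) the predicate of $r$. A *conflict* is a pair $(r,x)$ with $\mathsf{wr}_x^{-1}(r)$ undefined and $1_x^r\neq\emptyset$; $\#\mathrm{conf}(h)$ is the number of conflicts, $\mathrm{width}(h)$ the maximal number of pairwise $\mathsf{so}$-incomparable transactions, and $|h|$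 the number of keys, transactions and events. **The algorithm.** $\mathrm{checkConsistency}(h)$ computes $\mathsf{pco}$ by iterating saturate, the set $E_h$ of conflicts, and the set $X_h$ of maps sending each $(r,x)\in E_h$ to a member of $0_x^r$. It returns false if $\mathsf{pco}$ is cyclic or if $0_x^r=\emptyset$ for some $(r,x)\in E_h$; if $E_h=\emptyset$, it returns $\mathrm{explore}(h,\emptyset)$; otherwise, for each $f\in X_h$, it sets $\mathtt{seen}=\emptyset$, lets $h'$ be $h$ with every read $r$ made to read $x$ from $f(r,x)$ for $(r,x)\in E_h$, and returns true as soon as $\mathrm{explore}(h',\emptyset)$ does, and false if none does. $\mathrm{explore}(h,P)$ works on a set $T_P$ of transactions with a map $M_P$ giving the last added transaction that writes each key; it returns true if $T_P=T$; else, for each $t\in T\setminus T_P$ such that $P'=P\cup\{t\}$ is a consistent extension of $P$, it skips $P'$ if an equivalent prefix is in $\mathtt{seen}$, returns true if $\mathrm{explore}(h,P')$ does, and adds $P'$ to $\mathtt{seen}$ otherwise; finally it returns false. Prefixes are equivalent if they have the same $T_P$ and, when some transaction uses SI, also the same $M_P$. $P'$ is a consistent extension if (1) $(t',t)\in\mathsf{pco}$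 implies $t'\in T_P$, and (2) with $R=\mathsf{pco}\cup\{(t',t):t'\in T_P\}\cup\{(t,t''):t''\notin T_{P'}\}$, for every read $r$ outside $P'$ and every visibility relation $v$ of its isolation level: for $v\ne$ Conflict there is no key $x$ written by $t$ such that $r$ reads $x$ from $T_P$ and $t$ is visible to $r$ by $v$ and $R$; for $v=$ Conflict there are no key $x$ and $t'\in T_{P'}$ such that $t'$ writes $x$, $t'$ is visible to $r$ by $v$ and $R$, $r$ reads $x$ from some $u$, and, in the first version of the algorithm, $M_P(x)$ is defined and $u\ne M_P(x)$, resp., in the second version, $u\in T_{P'}$ and $u\ne M_{P'}(x)$. Running times count elementary steps on a random access machine with tables, where table accesses, comparisons of keys, transactions and events, and the evaluation of a row predicate on one row take one step, where $\mathsf{pco}$ is recomputed for every test of a consistent extension, and where $\mathtt{seen}$ is stored as a binary tree. **Theorem.** For both versions of the algorithm and all client histories $h$ whose transactions use isolation levels in $\{\mathrm{SER},\mathrm{SI},\mathrm{PC},\mathrm{RA},\mathrm{RC}\}$, $\mathrm{checkConsistency}$ runs in time $O\bigl(|h|^{\#\mathrm{conf}(h)+\mathrm{width}(h)+9}\cdot\mathrm{width}(h)^{|\mathsf{Keys}|}\bigr)$.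 If no transaction of $h$ uses SI, it runs in time $O\bigl(|h|^{\#\mathrm{conf}(h)+\mathrm{width}(h)+8}\bigr)$. The constants are absolute. Hence, for every $b$, it runs in time polynomial in $|h|$ on the conflict-free client histories of width at most $b$ in which no transaction uses SI. -/

import Mathlib

/-! # Histories of database transactions, a consistency-checking algorithm, and its running time -/

namespace MixedIso

/-! ## Histories -/

/-- The isolation levels: serializability, snapshot isolation, prefix consistency, read atomic,
read committed. -/
inductive IsoLevel
  | SER
  | SI
  | PC
  | RA
  | RC
  deriving DecidableEq

/-- A value stored under a key `x`: a row, or the special value `†ₓ` ("no row with key `x`"). The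
undefined value `⊥` is represented by `none : Option (Datum Row)`. -/
inductive Datum (Row : Type)
  | row (r : Row)
  | dagger

/-- Predicates on rows are extended to `†ₓ` by `false`. -/
def Datum.sat {Row : Type} (p : Row → Bool) : Datum Row → Bool
  | .row r => p r
  | .dagger => false

/-- Types of events. An inserted set of rows, with at most one row for each key, is given as the
partial map that sends a key `x` to the inserted row with key `x`. -/
inductive Kind (Key Row : Type)
  | beginTx
  | commit
  | abort
  | select (p : Row → Bool)
  | insert (R : Key → Option (Datum Row))
  | delete (p : Row → Bool)
  | update (p : Row → Bool) (U : Key → Row)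

namespace Kind

variable {Key Row : Type}

def isAbort : Kind Key Row → Bool
  | .abort => true
  | _ => false

def isEnd : Kind Key Row → Bool
  | .abort => true
  | .commit => true
  | _ => false

/-- Read events are `SELECT`, `DELETE` and `UPDATE`. -/
def isRead : Kind Key Row → Bool
  | .select _ => true
  | .delete _ => true
  | .update _ _ => true
  | _ => false

/-- Write events are `INSERT`, `DELETE` and `UPDATE`. -/
def isWrite : Kind Key Row → Bool
  | .insert _ => true
  | .delete _ => true
  | .update _ _ => true
  | _ => false

/-- The predicate `WHERE` of a read event (by convention constantly false for other events). -/
def whereP : Kind Key Row → Row → Bool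
  | .select p => p
  | .delete p => p
  | .update p _ => p
  | _ => fun _ => false

end Kind

/-- The data of a history over a database with the given keys and rows: the finite sets `Tx` of
transactions and `Ev` of events, the transaction `tr e` of an event, the program order `po` inside
transactions, the session order `so`, the isolation configuration `iso`, and the write-read
relations `wr_x`. As every `wr_x⁻¹` is a partial function, it is given as `wrInv x`. The laws are
stated in `IsHistory`. -/
structure History (Key Row Tx Ev : Type) where
  keyOf : Row → Key
  init : Tx
  iso : Tx → IsoLevel
  tr : Ev → Tx
  kind : Ev → Kind Key Row
  po : Ev → Ev → Bool
  so : Tx → Tx → Bool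
  wrInv : Key → Ev → Option Ev

namespace History

variable {Key Row Tx Ev : Type} (h : History Key Row Tx Ev)

/-- `(w, r) ∈ wr_x`. -/
def wr (x : Key) (w r : Ev) : Prop := h.wrInv x r = some w

def Aborted (t : Tx) : Prop := ∃ e, h.tr e = t ∧ (h.kind e).isAbort = true

def IsReadOp (r : Ev) : Prop := (h.kind r).isRead = true

/-- Write events of an aborted transaction do not count as writes of that transaction. -/
def IsWriteOp (w : Ev) : Prop := (h.kind w).isWrite = true ∧ ¬ h.Aborted (h.tr w)

/-- `h.HasValue x w d` says that `value_wr(w, x) = d ≠ ⊥`. -/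
inductive HasValue (x : Key) : Ev → Datum Row → Prop
  | ins (w : Ev) (R : Key → Option (Datum Row)) (d : Datum Row) :
      h.kind w = .insert R → R x = some d → HasValue x w d
  | del (w w' : Ev) (p : Row → Bool) (d : Datum Row) :
      h.kind w = .delete p → h.wr x w' w → HasValue x w' d → d.sat p = true →
      HasValue x w .dagger
  | upd (w w' : Ev) (p : Row → Bool) (U : Key → Row) (d : Datum Row) :
      h.kind w = .update p U → h.wr x w' w → HasValue x w' d → d.sat p = true →
      HasValue x w (.row (U x))

/-- The event `w` writes `x`. -/
def EvWrites (w : Ev) (x : Key) : Prop := (∃ d, h.HasValue x w d) ∧ ¬ h.Aborted (h.tr w)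

/-- The transaction `t` writes `x`. -/
def TxWrites (t : Tx) (x : Key) : Prop := ∃ w, h.tr w = t ∧ h.EvWrites w x

/-- `value_wr(t, x) = d`: the value written by the last event of `t` that writes `x`. -/
def TxValue (t : Tx) (x : Key) (d : Datum Row) : Prop :=
  ∃ w, h.tr w = t ∧ h.EvWrites w x ∧
    (∀ w', h.tr w' = t → h.EvWrites w' x → w' = w ∨ h.po w' w = true) ∧ h.HasValue x w d

/-- `(t, r) ∈ so ∪ wr`, for a transaction and an event. -/
def DepEv (t : Tx) (r : Ev) : Prop :=
  h.so t (h.tr r) = true ∨ (t ≠ h.tr r ∧ ∃ x w, h.wr x w r ∧ h.tr w = t)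

/-- `(t₁, t₂) ∈ so ∪ wr`, for transactions. -/
def Dep (t₁ t₂ : Tx) : Prop :=
  h.so t₁ t₂ = true ∨ (t₁ ≠ t₂ ∧ ∃ x w r, h.wr x w r ∧ h.tr w = t₁ ∧ h.tr r = t₂)

/-- The laws of histories. -/
structure IsHistory : Prop where
  /-- `po` is a strict total order on the events of each transaction. -/
  po_tr : ∀ e e', h.po e e' = true → h.tr e = h.tr e'
  po_irrefl : ∀ e, ¬ h.po e e = true
  po_trans : ∀ e₁ e₂ e₃, h.po e₁ e₂ = true → h.po e₂ e₃ = true → h.po e₁ e₃ = true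
  po_total : ∀ e e', h.tr e = h.tr e' → e ≠ e' → h.po e e' = true ∨ h.po e' e = true
  /-- The first event of a transaction is a `begin`. -/
  begin_first : ∀ t, ∃ e, h.tr e = t ∧ h.kind e = .beginTx ∧
    ∀ e', h.tr e' = t → e' ≠ e → h.po e e' = true
  /-- A `commit` or `abort` is the last event (so that a transaction has at most one of them). -/
  end_last : ∀ e, (h.kind e).isEnd = true →
    ∀ e', h.tr e' = h.tr e → e' ≠ e → h.po e' e = true
  /-- Inserted rows carry the key under which they are inserted. -/
  insert_key : ∀ e R x ρ, h.kind e = .insert R → R x = some (.row ρ) → h.keyOf ρ = x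
  /-- `so` is a strict partial order. -/
  so_irrefl : ∀ t, ¬ h.so t t = true
  so_trans : ∀ t₁ t₂ t₃, h.so t₁ t₂ = true → h.so t₂ t₃ = true → h.so t₁ t₃ = true
  /-- The initial transaction precedes all others, is not aborted, inserts a row (or `†ₓ`) for
  every key, and is the only one that may insert `†ₓ`. -/
  init_first : ∀ t, t ≠ h.init → h.so h.init t = true
  init_not_aborted : ¬ h.Aborted h.init
  init_insert : ∀ x, ∃ e R, h.tr e = h.init ∧ h.kind e = .insert R ∧ (R x).isSome = true
  insert_dagger : ∀ e R x, h.kind e = .insert R → R x = some .dagger → h.tr e = h.init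
  /-- `wr_x` relates write events that write `x` to read events. -/
  wr_write : ∀ x w r, h.wr x w r → h.IsWriteOp w
  wr_read : ∀ x w r, h.wr x w r → h.IsReadOp r
  wr_value : ∀ x w r, h.wr x w r → ∃ d, h.HasValue x w d
  /-- `so ∪ wr` is acyclic. -/
  acyclic : ∀ t, ¬ Relation.TransGen h.Dep t t

/-- In a full history every read `r` reads every key `x`, except where `r` is preceded in its
transaction by an event that writes `x`. -/
def IsFull : Prop :=
  h.IsHistory ∧ ∀ x r, h.IsReadOp r →
    (∃ w, h.wr x w r) ∨ (∃ w, h.po w r = true ∧ h.EvWrites w x)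

/-- `g` is a witness of `h`: a full history that only adds write-read dependencies to `h`, of
reads on writes whose value does not satisfy the predicate of the read. -/
def IsWitness (g : History Key Row Tx Ev) : Prop :=
  (∃ s, g = { h with wrInv := s }) ∧ g.IsFull ∧
  (∀ x w r, h.wr x w r → g.wr x w r) ∧
  (∀ x w r, g.wr x w r → ¬ h.wr x w r →
    ∀ d, g.HasValue x w d → d.sat (h.kind r).whereP = false)

/-- Client histories: histories that have a witness. -/
def IsClient : Prop := h.IsHistory ∧ ∃ g, h.IsWitness g

end History

/-! ## Visibility relations, the partial commit order, and the parameters of a history -/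

/-- Names of the visibility relations (one for each axiom). -/
inductive Vis
  | readCommitted
  | readAtomic
  | serializability
  | prefixVis
  | conflict
  deriving DecidableEq

/-- The visibility relations of an isolation level. -/
def IsoLevel.visSet : IsoLevel → List Vis
  | .SER => [.serializability]
  | .SI => [.prefixVis, .conflict]
  | .PC => [.prefixVis]
  | .RA => [.readAtomic]
  | .RC => [.readCommitted]

namespace History

variable {Key Row Tx Ev : Type} (h : History Key Row Tx Ev)

/-- `v(R)(t₂, r, x)`: the transaction `t₂` is visible to the read `r`, with the relation `R` in
the place of the commit order. None of the five relations depends on the key `x`. -/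
def Visible (R : Tx → Tx → Prop) (t₂ : Tx) (r : Ev) : Vis → Prop
  | .readCommitted => ∃ r', h.DepEv t₂ r' ∧ (r' = r ∨ h.po r' r = true)
  | .readAtomic => h.Dep t₂ (h.tr r)
  | .serializability => R t₂ (h.tr r)
  | .prefixVis => ∃ t₄, Relation.ReflTransGen R t₂ t₄ ∧ h.Dep t₄ (h.tr r)
  | .conflict => ∃ t₄ y, h.TxWrites t₄ y ∧ h.TxWrites (h.tr r) y ∧
      Relation.ReflTransGen R t₂ t₄ ∧ R t₄ (h.tr r)

/-- `saturate(h, R)`: the pairs of `R` and the pairs `(t₂, t₁)` that an axiom requires, given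
that `R` is part of the commit order. -/
def Saturate (R : Tx → Tx → Prop) (t₂ t₁ : Tx) : Prop :=
  R t₂ t₁ ∨ ∃ x r w, h.IsReadOp r ∧ t₂ ≠ h.tr r ∧ h.TxWrites t₂ x ∧ h.wr x w r ∧
    t₁ = h.tr w ∧ t₂ ≠ t₁ ∧ ∃ v ∈ (h.iso (h.tr r)).visSet, h.Visible R t₂ r v

/-- `pco`: the least fixpoint of `saturate(h, ·)` above `(so ∪ wr)⁺`. -/
def Pco (a b : Tx) : Prop :=
  ∀ R : Tx → Tx → Prop, (∀ s t, Relation.TransGen h.Dep s t → R s t) →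
    (∀ s t, h.Saturate R s t → R s t) → R a b

/-- `t ∈ 1_x^r(pco)`. -/
def OneSet (r : Ev) (x : Key) (t : Tx) : Prop :=
  ¬ h.Pco (h.tr r) t ∧ ∃ d, h.TxValue t x d ∧ d.sat (h.kind r).whereP = true

/-- `(r, x)` is a conflict: `wr_x⁻¹(r)` is undefined and `1_x^r(pco)` is not empty. -/
def IsConflict (r : Ev) (x : Key) : Prop :=
  h.IsReadOp r ∧ h.wrInv x r = none ∧ ∃ t, h.OneSet r x t

/-- `#conf(h)`, the number of conflicts. -/
noncomputable def numConf : ℕ := {p : Ev × Key | h.IsConflict p.1 p.2}.ncard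

open Classical in
/-- `width(h)`, the largest number of pairwise `so`-incomparable transactions. -/
noncomputable def width [Fintype Tx] : ℕ :=
  ((Finset.univ : Finset (Finset Tx)).filter fun A : Finset Tx =>
    IsAntichain (fun a b => h.so a b = true) (A : Set Tx)).sup Finset.card

/-- `|h|`: the number of keys, transactions and events. -/
def size (_ : History Key Row Tx Ev) [Fintype Key] [Fintype Tx] [Fintype Ev] : ℕ :=
  Fintype.card Key + Fintype.card Tx + Fintype.card Ev

end History

/-! ## The cost model

A program returns its result with the number of elementary steps it takes. Memory is random access:
finite sets are enumerated, and functions on them are tables. An elementary step (`op`) performs a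
bounded number of the following: reading a table entry, comparing two keys, transactions, events or
isolation levels, Boolean operations, evaluating a `WHERE` predicate or a `SET` map on one row,
overwriting one table entry, adding one item to the front of a list. All else is made of loops,
which pay for every iteration, and a new table or a copy of one is paid for entry by entry. A
program that changes an entry of a table does not use the old table any more. -/

structure Timed (α : Type) where
  val : α
  cost : ℕ

namespace Timed

instance : Monad Timed where
  pure a := ⟨a, 0⟩
  bind m f := ⟨(f m.val).val, m.cost + (f m.val).cost⟩

variable {α β σ ι : Type}

/-- One elementary step. -/
def op (a : α) : Timed α := ⟨a, 1⟩

/-- Builds a table. -/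
def tabulate [Fintype ι] (f : ι → Timed α) : Timed (ι → α) :=
  ⟨fun i => (f i).val, 1 + ∑ i, ((f i).cost + 1)⟩

/-- Loop that tests whether some `i` passes (without early exit). -/
def anyOf [Fintype ι] (f : ι → Timed Bool) : Timed Bool :=
  ⟨decide (∃ i, (f i).val = true), 1 + ∑ i, ((f i).cost + 1)⟩

/-- Loop that tests whether all `i` pass (without early exit). -/
def allOf [Fintype ι] (f : ι → Timed Bool) : Timed Bool :=
  ⟨decide (∀ i, (f i).val = true), 1 + ∑ i, ((f i).cost + 1)⟩

/-- Loop that finds an `i` that passes, if there is one (without early exit). -/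
def findOf [FinEnum ι] (f : ι → Timed Bool) : Timed (Option ι) :=
  ⟨(FinEnum.toList ι).find? fun i => (f i).val, 1 + ∑ i, ((f i).cost + 1)⟩

/-- Loop that lists all `i` that pass. -/
def filterOf [FinEnum ι] (f : ι → Timed Bool) : Timed (List ι) :=
  ⟨(FinEnum.toList ι).filter fun i => (f i).val, 1 + ∑ i, ((f i).cost + 1)⟩

/-- Loop that lists the results of `f` on the items of a list. -/
def mapList (f : α → Timed β) : List α → Timed (List β)
  | [] => op []
  | a :: l => do
    let b ← f a
    let bs ← mapList f l
    op (b :: bs)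

/-- Loop over a list that changes a state. -/
def forEach (body : α → σ → Timed σ) : List α → σ → Timed σ
  | [], s => op s
  | a :: l, s => do
    let s₁ ← op s
    let s₂ ← body a s₁
    forEach body l s₂

/-- Loop over a list that changes a state and is left with `true` as soon as the body returns
`true`. It returns `false` if it is never left. -/
def forUntil (body : α → σ → Timed (Bool × σ)) : List α → σ → Timed (Bool × σ)
  | [], s => op (false, s)
  | a :: l, s => do
    let s₁ ← op s
    let (b, s₂) ← body a s₁
    if b then op (true, s₂) else forUntil body l s₂

end Timed

open Timed

/-- Sets of Boolean strings, stored as binary trees. -/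
inductive Trie
  | leaf
  | node (mark : Bool) (zero one : Trie)

namespace Trie

def member : Trie → List Bool → Timed Bool
  | .leaf, _ => op false
  | .node m _ _, [] => op m
  | .node _ z o, b :: bs => do
    let c ← op b
    if c then o.member bs else z.member bs

def insert : Trie → List Bool → Timed Trie
  | .leaf, [] => op (.node true .leaf .leaf)
  | .node _ z o, [] => op (.node true z o)
  | .leaf, b :: bs => do
    let s ← insert .leaf bs
    op (if b then .node false .leaf s else .node false s .leaf)
  | .node m z o, b :: bs => do
    let s ← insert (if b then o else z) bs
    op (if b then .node m z s else .node m s o)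

end Trie

/-! ## The algorithm -/

namespace History

variable {Key Row Tx Ev : Type} [FinEnum Key] [FinEnum Tx] [FinEnum Ev]

/-- Computes `value_wr(w, x)` by following `wr_x⁻¹`. The first argument bounds the number of
recursive calls; the number of events suffices. -/
def evalValue (h : History Key Row Tx Ev) (x : Key) : ℕ → Ev → Timed (Option (Datum Row))
  | 0, _ => op none
  | n + 1, w =>
    match h.kind w with
    | .insert R => op (R x)
    | .delete p => do
      let s ← op (h.wrInv x w)
      match s with
      | none => op none
      | some w' => do
        let d ← evalValue h x n w'
        op (if d.any (Datum.sat p) then some .dagger else none)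
    | .update p U => do
      let s ← op (h.wrInv x w)
      match s with
      | none => op none
      | some w' => do
        let d ← evalValue h x n w'
        op (if d.any (Datum.sat p) then some (.row (U x)) else none)
    | _ => op none

/-- Auxiliary tables for a history: for each transaction `t` and key `x`, the last event of `t`
that writes `x`, if any, with the value written; the relation `so ∪ wr` between transactions and
events, and between transactions. -/
structure Tables (Key Row Tx Ev : Type) where
  last : Tx → Key → Option (Ev × Datum Row)
  depEv : Tx → Ev → Bool
  dep : Tx → Tx → Bool

/-- The transaction `t` writes `x`. -/
def Tables.writes (tb : Tables Key Row Tx Ev) (t : Tx) (x : Key) : Bool := (tb.last t x).isSome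

def buildTables (h : History Key Row Tx Ev) : Timed (Tables Key Row Tx Ev) := do
  let aborted ← tabulate fun t => anyOf fun e => op (decide (h.tr e = t) && (h.kind e).isAbort)
  let value ← tabulate fun (e : Ev) => tabulate fun (x : Key) =>
    if (h.kind e).isWrite && !aborted (h.tr e) then evalValue h x (Fintype.card Ev) e else op none
  let last ← tabulate fun (t : Tx) => tabulate fun (x : Key) => do
    let w ← findOf fun e =>
      if decide (h.tr e = t) && (value e x).isSome then
        allOf fun e' => op (!((value e' x).isSome && h.po e e'))
      else op false
    op (w.bind fun e => (value e x).map fun d => (e, d))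
  let depEv ← tabulate fun (t : Tx) => tabulate fun (r : Ev) => do
    let b ← anyOf fun x => op ((h.wrInv x r).any fun w => decide (h.tr w = t))
    op (h.so t (h.tr r) || (b && !decide (t = h.tr r)))
  let dep ← tabulate fun (t₁ : Tx) => tabulate fun (t₂ : Tx) => do
    let b ← anyOf fun r => op (decide (h.tr r = t₂) && depEv t₁ r)
    op (h.so t₁ t₂ || b)
  op ⟨last, depEv, dep⟩

/-- Transitive closure of a relation (Warshall's algorithm). -/
def transClosure (R : Tx → Tx → Bool) : Timed (Tx → Tx → Bool) :=
  forEach (fun k M => tabulate fun a => tabulate fun b => op (M a b || (M a k && M k b)))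
    (FinEnum.toList Tx) R

/-- Evaluates `v(R)(t₂, r, x)`, where `S` is the transitive closure of `R`. -/
def evalVis (h : History Key Row Tx Ev) (tb : Tables Key Row Tx Ev) (R S : Tx → Tx → Bool)
    (t₂ : Tx) (r : Ev) : Vis → Timed Bool
  | .readCommitted => anyOf fun r' => op (tb.depEv t₂ r' && (decide (r' = r) || h.po r' r))
  | .readAtomic => op (tb.dep t₂ (h.tr r))
  | .serializability => op (R t₂ (h.tr r))
  | .prefixVis => anyOf fun t₄ => op ((decide (t₂ = t₄) || S t₂ t₄) && tb.dep t₄ (h.tr r))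
  | .conflict => anyOf fun t₄ => anyOf fun y =>
      op (tb.writes t₄ y && tb.writes (h.tr r) y && (decide (t₂ = t₄) || S t₂ t₄) &&
        R t₄ (h.tr r))

/-- `saturate(h, R)`. -/
def saturate (h : History Key Row Tx Ev) (R : Tx → Tx → Bool) : Timed (Tx → Tx → Bool) := do
  let tb ← buildTables h
  let S ← transClosure R
  let res₀ ← tabulate fun a => tabulate fun b => op (R a b)
  forEach (fun (x : Key) res₁ =>
    forEach (fun (r : Ev) res₂ =>
      match h.wrInv x r with
      | none => op res₂
      | some w =>
        if (h.kind r).isRead then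
          forEach (fun (t₂ : Tx) res₃ =>
            if decide (t₂ ≠ h.tr r) && tb.writes t₂ x && decide (t₂ ≠ h.tr w) then
              forEach (fun (v : Vis) res₄ => do
                let b ← evalVis h tb R S t₂ r v
                op (fun s t => (b && decide (s = t₂ ∧ t = h.tr w)) || res₄ s t))
                (h.iso (h.tr r)).visSet res₃
            else op res₃)
            (FinEnum.toList Tx) res₂
        else op res₂)
      (FinEnum.toList Ev) res₁)
    (FinEnum.toList Key) res₀

/-- Iterates `saturate` until the relation does not change. The first argument bounds the number
of iterations. -/
def iterSaturate (h : History Key Row Tx Ev) :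
    ℕ → (Tx → Tx → Bool) → Timed (Tx → Tx → Bool)
  | 0, R => op R
  | n + 1, R => do
    let R' ← saturate h R
    let same ← allOf fun a => allOf fun b => op (R a b == R' a b)
    if same then op R' else iterSaturate h n R'

/-- Computes `pco`. As a change adds a pair, `|T|² + 1` iterations suffice. -/
def computePco (h : History Key Row Tx Ev) : Timed (Tx → Tx → Bool) := do
  let tb ← buildTables h
  let R ← transClosure tb.dep
  iterSaturate h (Fintype.card Tx ^ 2 + 1) R

def isCyclic (R : Tx → Tx → Bool) : Timed Bool := do
  let S ← transClosure R
  anyOf fun t => op (S t t)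

/-- A set `T_P` of transactions that are already committed, with the transaction `M_P(x)` of the
last write to each key `x`, which is undefined as long as there is none. -/
structure Committed (Key Tx : Type) where
  mem : Tx → Bool
  last : Key → Option Tx

def emptyCommitted : Timed (Committed Key Tx) := do
  let mem ← tabulate fun (_ : Tx) => op false
  let last ← tabulate fun (_ : Key) => op none
  op ⟨mem, last⟩

/-- `P ∪ {t}`. -/
def extend (h : History Key Row Tx Ev) (P : Committed Key Tx) (t : Tx) :
    Timed (Committed Key Tx) := do
  let tb ← buildTables h
  let mem ← tabulate fun s => op (P.mem s || decide (s = t))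
  let last ← tabulate fun x => op (if tb.writes t x then some t else P.last x)
  op ⟨mem, last⟩

/-- Two forms of the test that is made for the visibility relation `conflict` when `P` is extended
to `P' = P ∪ {t}` and a read `r` outside `P'` reads `x` from the transaction `u`, while some
transaction in `T_P'` that writes `x` is visible to `r`. The extension is rejected
* for `previous`, if `M_P(x)` is defined and `u ≠ M_P(x)`;
* for `current`, if `u ∈ T_P'` and `u ≠ M_P'(x)`. -/
inductive ConflictTest
  | previous
  | current

def rejects (test : ConflictTest) (tb : Tables Key Row Tx Ev) (P : Committed Key Tx) (t : Tx)
    (x : Key) (u : Tx) : Bool :=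
  match test with
  | .previous => (P.last x).any fun s => decide (u ≠ s)
  | .current => (P.mem u || decide (u = t)) &&
      decide ((if tb.writes t x then some t else P.last x) ≠ some u)

/-- The predicate on `P`, `t`, `r` for a visibility relation `v`, where `R` is `pco_t^P` and `S` is
its transitive closure. For `v ≠ conflict` it says that no read of `r` from a transaction in `T_P`
is overwritten by `t`. -/
def visCons (test : ConflictTest) (h : History Key Row Tx Ev) (tb : Tables Key Row Tx Ev)
    (R S : Tx → Tx → Bool) (P : Committed Key Tx) (t : Tx) (r : Ev) (v : Vis) : Timed Bool := do
  let bad ← anyOf fun (x : Key) =>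
    match h.wrInv x r with
    | none => op false
    | some w =>
      if v = .conflict then
        anyOf fun (t' : Tx) =>
          if (P.mem t' || decide (t' = t)) && tb.writes t' x && rejects test tb P t x (h.tr w) then
            evalVis h tb R S t' r v
          else op false
      else if tb.writes t x && P.mem (h.tr w) then evalVis h tb R S t r v
      else op false
  op (!bad)

/-- Decides whether `P ∪ {t}` is a consistent extension of `P`. -/
def isConsistentExtension (test : ConflictTest) (h : History Key Row Tx Ev)
    (P : Committed Key Tx) (t : Tx) : Timed Bool := do
  let pco ← computePco h
  let missing ← anyOf fun t' => op (!P.mem t' && pco t' t)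
  if missing then op false
  else do
    let tb ← buildTables h
    let R ← tabulate fun a => tabulate fun b =>
      op (pco a b || (P.mem a && decide (b = t)) ||
        (decide (a = t) && !P.mem b && !decide (b = t)))
    let S ← transClosure R
    allOf fun r =>
      if (h.kind r).isRead && !P.mem (h.tr r) && !decide (h.tr r = t) then
        forEach (fun v ok => do
          let b ← visCons test h tb R S P t r v
          op (ok && b))
          (h.iso (h.tr r)).visSet true
      else op true

/-- A Boolean string that determines `P` up to equivalence: if some transaction uses `SI`, two
prefixes are equivalent iff they have the same `T_P` and `M_P`, and otherwise iff they have the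
same `T_P`. -/
def encode (h : History Key Row Tx Ev) (P : Committed Key Tx) : Timed (List Bool) := do
  let hasSI ← anyOf fun t => op (decide (h.iso t = .SI))
  if hasSI then
    mapList (fun i => match i with
      | .inl t => op (P.mem t)
      | .inr (x, t) => op (decide (P.last x = some t)))
      (FinEnum.toList (Tx ⊕ Key × Tx))
  else mapList (fun t => op (P.mem t)) (FinEnum.toList Tx)

/-- `exploreConsistentPrefixes(h, P)`. The set `seen` is threaded through the calls. The first
argument bounds the depth of the recursion; `|T| + 1` suffices. -/
def explore (test : ConflictTest) (h : History Key Row Tx Ev) :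
    ℕ → Committed Key Tx → Trie → Timed (Bool × Trie)
  | 0, _, seen => op (false, seen)
  | n + 1, P, seen => do
    let full ← allOf fun t => op (P.mem t)
    if full then op (true, seen)
    else
      forUntil (fun t seen₁ =>
        if P.mem t then op (false, seen₁)
        else do
          let ok ← isConsistentExtension test h P t
          if !ok then op (false, seen₁)
          else do
            let Q ← extend h P t
            let code ← encode h Q
            let old ← seen₁.member code
            if old then op (false, seen₁)
            else do
              let (found, seen₂) ← explore test h n Q seen₁
              if found then op (true, seen₂)
              else do
                let seen₃ ← seen₂.insert code
                op (false, seen₃))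
        (FinEnum.toList Tx) seen

/-- Runs `exploreConsistentPrefixes(h, ∅)` with `seen = ∅`. -/
def exploreFromEmpty (test : ConflictTest) (h : History Key Row Tx Ev) : Timed Bool := do
  let P ← emptyCommitted
  let (b, _) ← explore test h (Fintype.card Tx + 1) P .leaf
  op b

/-- The list of all mappings that choose, for each item `p` of a list, a transaction from the list
that comes with `p`. -/
def choices : List ((Ev × Key) × List Tx) → Timed (List (List ((Ev × Key) × Tx)))
  | [] => op [[]]
  | (p, ts) :: l => do
    let fs ← choices l
    forEach (fun t acc => forEach (fun f acc' => op (((p, t) :: f) :: acc')) fs acc) ts []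

/-- `h ⊕ wr_x(f(r, x), r)` for all `(r, x)`: the read `r` is made to read `x` from the last event of
the transaction `f(r, x)` that writes `x`. -/
def addReads (h : History Key Row Tx Ev) (f : List ((Ev × Key) × Tx)) :
    Timed (History Key Row Tx Ev) := do
  let tb ← buildTables h
  let s₀ ← tabulate fun x => tabulate fun r => op (h.wrInv x r)
  let s ← forEach (fun c s =>
      op fun x r => if x = c.1.2 ∧ r = c.1.1 then (tb.last c.2 x).map Prod.fst else s x r)
    f s₀
  op { h with wrInv := s }

/-- `checkConsistency(h)`. -/
def checkConsistency (test : ConflictTest) (h : History Key Row Tx Ev) : Timed Bool := do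
  let pco ← computePco h
  let tb ← buildTables h
  -- the set `E_h` of conflicts
  let E ← filterOf fun (p : Ev × Key) =>
    if (h.kind p.1).isRead && (h.wrInv p.2 p.1).isNone then
      anyOf fun t => op (!pco (h.tr p.1) t &&
        (tb.last t p.2).any fun d => d.2.sat (h.kind p.1).whereP)
    else op false
  -- each conflict with its set `0_x^r(pco)`
  let Z ← mapList (fun (p : Ev × Key) => do
    let ts ← filterOf fun (t : Tx) => op (!pco (h.tr p.1) t &&
      (tb.last t p.2).any fun d => !d.2.sat (h.kind p.1).whereP)
    op (p, ts)) E
  -- the set `X_h` of mappings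
  let X ← choices Z
  let cyclic ← isCyclic pco
  if cyclic then op false
  else do
    let stuck ← forEach (fun z b => op (b || z.2.isEmpty)) Z false
    if stuck then op false
    else if E.isEmpty then exploreFromEmpty test h
    else do
      let (b, _) ← forUntil (fun f (u : Unit) => do
        let h' ← addReads h f
        let b ← exploreFromEmpty test h'
        op (b, u)) X ()
      op b

end History

end MixedIso

/-! The exploration can reach few inequivalent prefixes, it explores each of them at most once, and
the work for each prefix is polynomial.

Counting. A reachable set `T_P` is closed under `so`-predecessors, hence determined by its maximal
elements. These form an antichain, so there are at most `(|T| + 1) ^ width` such sets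
(`card_downClosed_le`). The transaction `M_P(x)` is maximal among the members of `T_P` that write
`x` (`Reachable`), which leaves at most `width` candidates for each key (`exists_codeBound`).
Without SI the code of a prefix forgets `M_P`, and the factor `width ^ |Keys|` disappears
(`exists_codeBound_of_no_SI`).

Amortization. The code of a prefix enters `seen` when its exploration has failed, and it was not
there before. The failed call is charged to this insertion. The successful calls form one chain, of
length at most `|T| + 1`, which is paid for separately (`cost_explore_amortized`).

Work per prefix. A loop over keys, transactions or events raises the exponent of the cost by one
(`loop_le`). A visibility test costs `n ^ e`, where `e = 2` covers all levels and `e = 1` suffices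
without SI. A round of `saturate` then costs `n ^ (e + 3)`, the at most `|T|² + 1` rounds for `pco`
cost `n ^ (e + 5)`, and the loop over the candidates that extend one prefix costs `n ^ (e + 6)`. The
mappings in `X_h` contribute the factor `n ^ #conf` (`length_choices_le`).

Correctness of the program matters only where it bounds a count. Every conflict that is found must
be a conflict, for which it suffices that the computed values are right and that the computed
relation contains `Pco` (`length_conflicts_le`). Every accepted extension must respect `so`
(`isConsistentExtension_so`). Explorations also run on histories with added reads, where only
`OrderLaws` is available; `so`, `width` and the isolation levels stay the same there. -/

namespace MixedIso

open Timed

set_option linter.unusedSectionVars false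

/-! ### Values and costs of the basic programs and loops. -/

namespace Timed

variable {α β σ ι : Type}

@[simp] theorem val_bind (m : Timed α) (f : α → Timed β) : (m >>= f).val = (f m.val).val := rfl
@[simp] theorem cost_bind (m : Timed α) (f : α → Timed β) :
    (m >>= f).cost = m.cost + (f m.val).cost := rfl
@[simp] theorem val_op (a : α) : (op a).val = a := rfl
@[simp] theorem cost_op (a : α) : (op a).cost = 1 := rfl

@[simp] theorem val_tabulate [Fintype ι] (f : ι → Timed α) (i : ι) :
    (tabulate f).val i = (f i).val := rfl

@[simp] theorem val_anyOf [Fintype ι] (f : ι → Timed Bool) :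
    (anyOf f).val = true ↔ ∃ i, (f i).val = true := by
  simp [anyOf]

@[simp] theorem val_allOf [Fintype ι] (f : ι → Timed Bool) :
    (allOf f).val = true ↔ ∀ i, (f i).val = true := by
  simp [allOf]

theorem val_filterOf [FinEnum ι] (f : ι → Timed Bool) :
    (filterOf f).val = (FinEnum.toList ι).filter fun i => (f i).val := rfl

theorem loop_sum_le [Fintype ι] {f : ι → Timed α} {c : ℕ} (hf : ∀ i, (f i).cost ≤ c) :
    1 + ∑ i, ((f i).cost + 1) ≤ 1 + Fintype.card ι * (c + 1) := by
  have := Finset.sum_le_card_nsmul Finset.univ (fun i => (f i).cost + 1) (c + 1)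
    (fun i _ => Nat.succ_le_succ (hf i))
  simpa using this

/-- The rule behind all cost bounds `C * n ^ k`: a loop with at most `n` iterations adds one to the
exponent and two to the constant, one for the overhead of the iterations and one for the start of
the loop. -/
theorem loop_le {m n c C k : ℕ} (hn : 1 ≤ n) (hm : m ≤ n) (hc : c ≤ C * n ^ k) :
    1 + m * (c + 1) ≤ (C + 2) * n ^ (k + 1) := by
  have h1 : 1 ≤ n ^ k := Nat.one_le_pow _ _ hn
  have h2 : 1 ≤ n ^ (k + 1) := Nat.one_le_pow _ _ hn
  calc 1 + m * (c + 1) ≤ n ^ (k + 1) + n * (C * n ^ k + n ^ k) := by gcongr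
    _ = (C + 2) * n ^ (k + 1) := by ring

theorem cost_tabulate_le [Fintype ι] {f : ι → Timed α} {n C k : ℕ} (hn : 1 ≤ n)
    (hm : Fintype.card ι ≤ n) (hf : ∀ i, (f i).cost ≤ C * n ^ k) :
    (tabulate f).cost ≤ (C + 2) * n ^ (k + 1) :=
  (loop_sum_le hf).trans (loop_le hn hm le_rfl)

theorem cost_anyOf_le [Fintype ι] {f : ι → Timed Bool} {n C k : ℕ} (hn : 1 ≤ n)
    (hm : Fintype.card ι ≤ n) (hf : ∀ i, (f i).cost ≤ C * n ^ k) :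
    (anyOf f).cost ≤ (C + 2) * n ^ (k + 1) :=
  (loop_sum_le hf).trans (loop_le hn hm le_rfl)

theorem cost_allOf_le [Fintype ι] {f : ι → Timed Bool} {n C k : ℕ} (hn : 1 ≤ n)
    (hm : Fintype.card ι ≤ n) (hf : ∀ i, (f i).cost ≤ C * n ^ k) :
    (allOf f).cost ≤ (C + 2) * n ^ (k + 1) :=
  (loop_sum_le hf).trans (loop_le hn hm le_rfl)

theorem cost_findOf_le [FinEnum ι] {f : ι → Timed Bool} {n C k : ℕ} (hn : 1 ≤ n)
    (hm : Fintype.card ι ≤ n) (hf : ∀ i, (f i).cost ≤ C * n ^ k) :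
    (findOf f).cost ≤ (C + 2) * n ^ (k + 1) :=
  (loop_sum_le hf).trans (loop_le hn hm le_rfl)

theorem cost_filterOf_le [FinEnum ι] {f : ι → Timed Bool} {n C k : ℕ} (hn : 1 ≤ n)
    (hm : Fintype.card ι ≤ n) (hf : ∀ i, (f i).cost ≤ C * n ^ k) :
    (filterOf f).cost ≤ (C + 2) * n ^ (k + 1) :=
  (loop_sum_le hf).trans (loop_le hn hm le_rfl)

theorem length_toList [FinEnum ι] : (FinEnum.toList ι).length = Fintype.card ι := by
  rw [← FinEnum.card_eq_fintypeCard]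
  simp [FinEnum.toList]

theorem cost_filterOf_le' [FinEnum ι] {f : ι → Timed Bool} {c : ℕ} (hf : ∀ i, (f i).cost ≤ c) :
    (filterOf f).cost ≤ 1 + (FinEnum.toList ι).length * (c + 1) := by
  rw [length_toList]
  exact loop_sum_le hf

theorem val_mapList (f : α → Timed β) (l : List α) :
    (mapList f l).val = l.map fun a => (f a).val := by
  induction l with
  | nil => rfl
  | cons a l ih => simp [mapList, ih]

theorem cost_mapList_le' {f : α → Timed β} {c : ℕ} {l : List α} (hf : ∀ a ∈ l, (f a).cost ≤ c) :
    (mapList f l).cost ≤ 1 + l.length * (c + 1) := by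
  induction l with
  | nil => simp [mapList]
  | cons a l ih =>
    have h1 := ih fun b hb => hf b (List.mem_cons_of_mem _ hb)
    have h2 := hf a List.mem_cons_self
    simp only [mapList, cost_bind, cost_op, List.length_cons]
    linarith

theorem cost_forEach_le' {body : α → σ → Timed σ} {c : ℕ} {l : List α}
    (hb : ∀ a ∈ l, ∀ s, (body a s).cost ≤ c) (s : σ) :
    (forEach body l s).cost ≤ 1 + l.length * (c + 1) := by
  induction l generalizing s with
  | nil => simp [forEach]
  | cons a l ih =>
    have h1 := ih (fun b hb' => hb b (List.mem_cons_of_mem _ hb')) (body a s).val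
    have h2 := hb a List.mem_cons_self s
    simp only [forEach, cost_bind, cost_op, val_op, List.length_cons]
    linarith

theorem cost_forEach_le {body : α → σ → Timed σ} {l : List α} {n C k : ℕ} (hn : 1 ≤ n)
    (hm : l.length ≤ n) (hb : ∀ a ∈ l, ∀ s, (body a s).cost ≤ C * n ^ k) (s : σ) :
    (forEach body l s).cost ≤ (C + 2) * n ^ (k + 1) :=
  (cost_forEach_le' hb s).trans (loop_le hn hm le_rfl)

theorem cost_forUntil_le {body : α → σ → Timed (Bool × σ)} {c : ℕ} {l : List α}
    (hb : ∀ a ∈ l, ∀ s, (body a s).cost ≤ c) (s : σ) :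
    (forUntil body l s).cost ≤ 1 + l.length * (c + 2) := by
  induction l generalizing s with
  | nil => simp [forUntil]
  | cons a l ih =>
    have h1 := ih (fun b hb' => hb b (List.mem_cons_of_mem _ hb')) (body a s).val.2
    have h2 := hb a List.mem_cons_self s
    simp only [forUntil, cost_bind, cost_op, val_op, List.length_cons]
    split
    · simp only [cost_op]; nlinarith
    · linarith

theorem forEach_keep {body : α → σ → Timed σ} {p : σ → Prop}
    (keep : ∀ a s, p s → p (body a s).val) (l : List α) (s : σ) (hs : p s) :
    p (forEach body l s).val := by
  induction l generalizing s with
  | nil => exact hs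
  | cons a l ih => exact ih _ (keep a s hs)

/-- One item establishes `p` from any state, and no later item destroys it. This is how a pair is
shown to be in a relation that nested loops only enlarge. -/
theorem forEach_of_mem {body : α → σ → Timed σ} {p : σ → Prop}
    (keep : ∀ a s, p s → p (body a s).val) {l : List α} {a : α} (ha : a ∈ l)
    (hit : ∀ s, p (body a s).val) (s : σ) : p (forEach body l s).val := by
  induction l generalizing s with
  | nil => cases ha
  | cons b l ih =>
    rcases List.mem_cons.1 ha with rfl | ha
    · exact forEach_keep keep l _ (hit s)
    · exact ih ha _

end Timed

/-! ### Binary trees as sets of codes. -/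

namespace Trie

theorem member_insert (t : Trie) (l l' : List Bool) :
    ((t.insert l).val.member l').val = true ↔ l' = l ∨ (t.member l').val = true := by
  induction l generalizing t l' with
  | nil => cases t <;> cases l' <;> simp [insert, member]
  | cons b l ih =>
    cases t <;> cases l' with
    | nil => cases b <;> simp [insert, member]
    | cons c l' =>
      cases b <;> cases c <;> simp [insert, member, ih]

/-- The walk consumes one bit of the code per step, so the cost does not depend on how many codes
are stored. -/
theorem cost_member_le (t : Trie) (l : List Bool) : (t.member l).cost ≤ 1 + l.length := by
  induction l generalizing t with
  | nil => cases t <;> simp [member]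
  | cons b l ih =>
    cases t with
    | leaf => simp [member]
    | node m z o =>
      have := ih z
      have := ih o
      cases b <;> simp [member] <;> omega

theorem cost_insert_le (t : Trie) (l : List Bool) : (t.insert l).cost ≤ 1 + l.length := by
  induction l generalizing t with
  | nil => cases t <;> simp [insert]
  | cons b l ih =>
    cases t with
    | leaf =>
      have := ih .leaf
      simp [insert]; omega
    | node m z o =>
      have := ih z
      have := ih o
      cases b <;> simp [insert] <;> omega

end Trie

namespace History

variable {Key Row Tx Ev : Type}

/-! ## Correctness of the computed tables -/

theorem hasValue_of_evalValue (h : History Key Row Tx Ev) (x : Key) (n : ℕ) (w : Ev)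
    (d : Datum Row) (hd : (h.evalValue x n w).val = some d) : h.HasValue x w d := by
  induction n generalizing w d with
  | zero => simp [evalValue] at hd
  | succ n ih =>
    rw [evalValue] at hd
    split at hd
    · exact .ins _ _ _ (by assumption) (by simpa using hd)
    · rename_i p hk
      simp only [val_bind, val_op] at hd
      cases hw : h.wrInv x w with
      | none => simp [hw] at hd
      | some w' =>
        simp only [hw, val_bind, val_op] at hd
        split at hd
        · rename_i hp
          obtain ⟨d', hd', hs⟩ := (Option.any_eq_true_iff_get _ _).1 hp |> fun ⟨a, b⟩ =>
            (⟨_, (Option.some_get a).symm, b⟩ : ∃ d' : Datum Row, _ = some d' ∧ d'.sat p = true)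
          cases hd
          exact .del _ _ _ _ hk hw (ih _ _ hd') hs
        · cases hd
    · rename_i p U hk
      simp only [val_bind, val_op] at hd
      cases hw : h.wrInv x w with
      | none => simp [hw] at hd
      | some w' =>
        simp only [hw, val_bind, val_op] at hd
        split at hd
        · rename_i hp
          obtain ⟨d', hd', hs⟩ := (Option.any_eq_true_iff_get _ _).1 hp |> fun ⟨a, b⟩ =>
            (⟨_, (Option.some_get a).symm, b⟩ : ∃ d' : Datum Row, _ = some d' ∧ d'.sat p = true)
          cases hd
          exact .upd _ _ _ _ _ hk hw (ih _ _ hd') hs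
        · cases hd
    · simp at hd

theorem evalValue_ins {h : History Key Row Tx Ev} {x : Key} {w : Ev}
    {R : Key → Option (Datum Row)} (hk : h.kind w = .insert R) (n : ℕ) :
    (h.evalValue x (n + 1) w).val = R x := by
  rw [evalValue, hk]; rfl

theorem evalValue_del {h : History Key Row Tx Ev} {x : Key} {w w' : Ev} {p : Row → Bool}
    (hk : h.kind w = .delete p) (hw : h.wrInv x w = some w') (n : ℕ) :
    (h.evalValue x (n + 1) w).val =
      if (h.evalValue x n w').val.any (Datum.sat p) then some .dagger else none := by
  rw [evalValue, hk]; simp [hw]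

theorem evalValue_upd {h : History Key Row Tx Ev} {x : Key} {w w' : Ev} {p : Row → Bool}
    {U : Key → Row} (hk : h.kind w = .update p U) (hw : h.wrInv x w = some w') (n : ℕ) :
    (h.evalValue x (n + 1) w).val =
      if (h.evalValue x n w').val.any (Datum.sat p) then some (.row (U x)) else none := by
  rw [evalValue, hk]; simp [hw]

theorem evalValue_mono {h : History Key Row Tx Ev} {x : Key} {n m : ℕ} {w : Ev}
    {d : Datum Row} (hnm : n ≤ m) (hd : (h.evalValue x n w).val = some d) :
    (h.evalValue x m w).val = some d := by
  have key := hasValue_of_evalValue h x n w d hd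
  induction n generalizing w d m with
  | zero => simp [evalValue] at hd
  | succ n ih =>
    obtain ⟨m, rfl⟩ : ∃ k, m = k + 1 := ⟨m - 1, by omega⟩
    cases key with
    | ins _ R _ hk hR => rw [evalValue_ins hk] at hd ⊢; exact hd
    | del _ w' p d' hk hw hv hs =>
      rw [evalValue_del hk hw] at hd ⊢
      split at hd
      · rename_i hp
        obtain ⟨d'', hd''⟩ : ∃ d'', (h.evalValue x n w').val = some d'' := by
          cases hq : (h.evalValue x n w').val with
          | none => simp [hq] at hp
          | some a => exact ⟨a, rfl⟩
        have := ih (m := m) (by omega) hd'' (hasValue_of_evalValue h x n w' _ hd'')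
        rw [hd''] at hp
        rw [this, if_pos hp]
      · cases hd
    | upd _ w' p U d' hk hw hv hs =>
      rw [evalValue_upd hk hw] at hd ⊢
      split at hd
      · rename_i hp
        obtain ⟨d'', hd''⟩ : ∃ d'', (h.evalValue x n w').val = some d'' := by
          cases hq : (h.evalValue x n w').val with
          | none => simp [hq] at hp
          | some a => exact ⟨a, rfl⟩
        have := ih (m := m) (by omega) hd'' (hasValue_of_evalValue h x n w' _ hd'')
        rw [hd''] at hp
        rw [this, if_pos hp]
      · cases hd

theorem exists_evalValue {h : History Key Row Tx Ev} {x : Key} {w : Ev} {d : Datum Row}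
    (hv : h.HasValue x w d) : ∃ n, (h.evalValue x n w).val = some d := by
  induction hv with
  | ins w R d hk hR => exact ⟨1, by rw [evalValue_ins hk, hR]⟩
  | del w w' p d hk hw hv hs ih =>
    obtain ⟨n, hn⟩ := ih
    exact ⟨n + 1, by rw [evalValue_del hk hw, hn]; simp [hs]⟩
  | upd w w' p U d hk hw hv hs ih =>
    obtain ⟨n, hn⟩ := ih
    exact ⟨n + 1, by rw [evalValue_upd hk hw, hn]; simp [hs]⟩

/-- The recursion depth at which the value of `w` becomes known is exactly `k + 1`. -/
def ValueDepth (h : History Key Row Tx Ev) (x : Key) (k : ℕ) (w : Ev) : Prop :=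
  (h.evalValue x k w).val = none ∧ (h.evalValue x (k + 1) w).val ≠ none

/-- An insertion is evaluated without recursion. For a DELETE or UPDATE, one level of depth is spent
on the step to the event it reads from, so that event becomes known exactly one level earlier. -/
theorem ValueDepth.pred {h : History Key Row Tx Ev} {x : Key} {k : ℕ} {w : Ev}
    (hw : h.ValueDepth x (k + 1) w) : ∃ w', h.ValueDepth x k w' := by
  obtain ⟨h0, h1⟩ := hw
  obtain ⟨d, hd⟩ := Option.ne_none_iff_exists'.1 h1
  have key := hasValue_of_evalValue h x _ w d hd
  cases key with
  | ins _ R _ hk hR => rw [evalValue_ins hk] at h0 h1; exact absurd h0 h1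
  | del _ w' p d' hk hw hv hs =>
    refine ⟨w', ?_, ?_⟩
    · by_contra hne
      obtain ⟨d'', hd''⟩ := Option.ne_none_iff_exists'.1 hne
      rw [evalValue_del hk hw, hd''] at h0
      rw [evalValue_del hk hw, evalValue_mono (Nat.le_succ k) hd''] at h1
      exact h1 h0
    · intro hne
      rw [evalValue_del hk hw, hne] at h1
      simp at h1
  | upd _ w' p U d' hk hw hv hs =>
    refine ⟨w', ?_, ?_⟩
    · by_contra hne
      obtain ⟨d'', hd''⟩ := Option.ne_none_iff_exists'.1 hne
      rw [evalValue_upd hk hw, hd''] at h0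
      rw [evalValue_upd hk hw, evalValue_mono (Nat.le_succ k) hd''] at h1
      exact h1 h0
    · intro hne
      rw [evalValue_upd hk hw, hne] at h1
      simp at h1

theorem ValueDepth.exists_of_le {h : History Key Row Tx Ev} {x : Key} {k : ℕ} {w : Ev}
    (hw : h.ValueDepth x k w) {j : ℕ} (hj : j ≤ k) : ∃ w', h.ValueDepth x j w' := by
  induction k generalizing w with
  | zero => obtain rfl : j = 0 := by omega
            exact ⟨w, hw⟩
  | succ k ih =>
    rcases Nat.lt_or_ge k j with h1 | h1
    · obtain rfl : j = k + 1 := by omega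
      exact ⟨w, hw⟩
    · obtain ⟨w', hw'⟩ := hw.pred
      exact ih hw' h1

theorem ValueDepth.unique {h : History Key Row Tx Ev} {x : Key} {i j : ℕ} {w : Ev}
    (hi : h.ValueDepth x i w) (hj : h.ValueDepth x j w) : i = j := by
  have aux : ∀ {a b : ℕ}, h.ValueDepth x a w → h.ValueDepth x b w → ¬ a < b := by
    intro a b ha hb hab
    obtain ⟨d, hd⟩ := Option.ne_none_iff_exists'.1 ha.2
    have := evalValue_mono (m := b) hab hd
    rw [hb.1] at this
    cases this
  exact le_antisymm (not_lt.1 (aux hj hi)) (not_lt.1 (aux hi hj))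

theorem HasValue.isWrite {h : History Key Row Tx Ev} {x : Key} {w : Ev} {d : Datum Row}
    (hv : h.HasValue x w d) : (h.kind w).isWrite = true := by
  cases hv <;> simp [Kind.isWrite, *]

/-- The laws of histories that do not mention `wr`. -/
structure OrderLaws (h : History Key Row Tx Ev) : Prop where
  po_tr : ∀ e e', h.po e e' = true → h.tr e = h.tr e'
  po_irrefl : ∀ e, ¬ h.po e e = true
  po_trans : ∀ e₁ e₂ e₃, h.po e₁ e₂ = true → h.po e₂ e₃ = true → h.po e₁ e₃ = true
  po_total : ∀ e e', h.tr e = h.tr e' → e ≠ e' → h.po e e' = true ∨ h.po e' e = true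
  so_irrefl : ∀ t, ¬ h.so t t = true
  so_trans : ∀ t₁ t₂ t₃, h.so t₁ t₂ = true → h.so t₂ t₃ = true → h.so t₁ t₃ = true
  init_first : ∀ t, t ≠ h.init → h.so h.init t = true
  init_not_aborted : ¬ h.Aborted h.init
  init_insert : ∀ x, ∃ e R, h.tr e = h.init ∧ h.kind e = .insert R ∧ (R x).isSome = true

/-- `addReads` replaces `wrInv` and may destroy the laws about `wr`, such as acyclicity. The laws
collected here survive any replacement. -/
theorem IsHistory.orderLaws {h : History Key Row Tx Ev} (hh : h.IsHistory)
    (s : Key → Ev → Option Ev) : OrderLaws { h with wrInv := s } where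
  po_tr := hh.po_tr
  po_irrefl := hh.po_irrefl
  po_trans := hh.po_trans
  po_total := hh.po_total
  so_irrefl := hh.so_irrefl
  so_trans := hh.so_trans
  init_first := hh.init_first
  init_not_aborted := hh.init_not_aborted
  init_insert := hh.init_insert

variable [FinEnum Key] [FinEnum Tx] [FinEnum Ev]

/-- All depths `0, …, k` are attained, and by different events since the depth of an event is
unique; the pigeonhole principle gives `k + 1 ≤ |Ev|`. This works for every `wrInv`, including
cyclic ones that `addReads` may produce. -/
theorem ValueDepth.lt_card {h : History Key Row Tx Ev} {x : Key} {k : ℕ} {w : Ev}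
    (hw : h.ValueDepth x k w) : k < Fintype.card Ev := by
  have hex : ∀ j : Fin (k + 1), ∃ w', h.ValueDepth x j w' := fun j =>
    hw.exists_of_le (Nat.lt_succ_iff.1 j.2)
  choose f hf using hex
  have hinj : Function.Injective f := by
    intro a b hab
    have h1 := hf a
    rw [hab] at h1
    exact Fin.ext (h1.unique (hf b))
  have := Fintype.card_le_of_injective f hinj
  simpa using this

theorem evalValue_card_eq_some_iff {h : History Key Row Tx Ev} {x : Key} {w : Ev}
    {d : Datum Row} :
    (h.evalValue x (Fintype.card Ev) w).val = some d ↔ h.HasValue x w d := by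
  refine ⟨hasValue_of_evalValue h x _ w d, fun hv => ?_⟩
  classical
  have hex : ∃ n, (h.evalValue x n w).val ≠ none := by
    obtain ⟨n, hn⟩ := exists_evalValue hv
    exact ⟨n, by simp [hn]⟩
  have hpos : Nat.find hex ≠ 0 := by
    intro h0
    have := Nat.find_spec hex
    rw [h0] at this
    exact this rfl
  obtain ⟨k, hk⟩ := Nat.exists_eq_succ_of_ne_zero hpos
  have hdep : h.ValueDepth x k w := by
    refine ⟨?_, ?_⟩
    · by_contra hne
      exact Nat.find_min hex (by omega) hne
    · have := Nat.find_spec hex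
      rwa [hk] at this
  obtain ⟨d', hd'⟩ := Option.ne_none_iff_exists'.1 hdep.2
  have hd'' := evalValue_mono hdep.lt_card hd'
  obtain ⟨n, hn⟩ := exists_evalValue hv
  -- Evaluating at a common depth shows that the value of an event is unique, so `d' = d`.
  have h1 := evalValue_mono (le_max_left n (k + 1)) hn
  have h2 := evalValue_mono (le_max_right n (k + 1)) hd'
  rw [h1] at h2
  cases h2
  exact hd''

/-- The value table that is computed on the way to the auxiliary tables. -/
theorem buildTables_value_iff (h : History Key Row Tx Ev) (e : Ev) (x : Key) (d : Datum Row) :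
    (if (h.kind e).isWrite && !(anyOf fun e' =>
        op (decide (h.tr e' = h.tr e) && (h.kind e').isAbort)).val
      then evalValue h x (Fintype.card Ev) e else op none).val = some d ↔
      h.HasValue x e d ∧ ¬ h.Aborted (h.tr e) := by
  have hab : (anyOf fun e' : Ev =>
      op (decide (h.tr e' = h.tr e) && (h.kind e').isAbort)).val = true ↔
      h.Aborted (h.tr e) := by
    simp [Aborted]
  by_cases ha : h.Aborted (h.tr e)
  · simp [hab.2 ha, ha]
  · rw [Bool.eq_false_of_not_eq_true (mt hab.1 ha)]
    cases hk : (h.kind e).isWrite with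
    | false =>
      simp only [Bool.false_and, Bool.false_eq_true, if_false, val_op, reduceCtorEq, false_iff,
        not_and]
      intro hv
      rw [hv.isWrite] at hk
      cases hk
    | true => simp [evalValue_card_eq_some_iff, ha]

/-- Isolates the search for the last writing event from the rest of `buildTables`: `value` is the
computed value table and `q` is the test of the search. Both the soundness and the completeness of
the table `last` are derived from this description. -/
theorem buildTables_last (h : History Key Row Tx Ev) (t : Tx) (x : Key) :
    ∃ (value : Ev → Option (Datum Row)),
      (∀ e d, value e = some d ↔ h.HasValue x e d ∧ ¬ h.Aborted (h.tr e)) ∧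
      ∃ q : Ev → Bool, (∀ e, q e = true ↔ h.tr e = t ∧ (value e).isSome = true ∧
          ∀ e', ¬ ((value e').isSome = true ∧ h.po e e' = true)) ∧
        (buildTables h).val.last t x =
          ((FinEnum.toList Ev).find? q).bind fun e => (value e).map fun d => (e, d) := by
  obtain ⟨V, hV⟩ : ∃ V : Ev → Option (Datum Row), V = fun e =>
      (if (h.kind e).isWrite && !(anyOf fun e' =>
        op (decide (h.tr e' = h.tr e) && (h.kind e').isAbort)).val
      then evalValue h x (Fintype.card Ev) e else op none).val := ⟨_, rfl⟩
  refine ⟨V, fun e d => by rw [hV]; exact buildTables_value_iff h e x d,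
    fun e => (if decide (h.tr e = t) && (V e).isSome then
        allOf fun e' => op (!((V e').isSome && h.po e e')) else op false).val, ?_, ?_⟩
  · intro e
    by_cases hc : h.tr e = t ∧ (V e).isSome = true
    · simp [hc.1, hc.2, or_iff_not_imp_left, Option.isSome_iff_ne_none]
    · dsimp only
      rw [if_neg (by simpa only [Bool.and_eq_true, decide_eq_true_eq] using hc)]
      simp only [val_op, Bool.false_eq_true, false_iff]
      exact fun H => hc ⟨H.1, H.2.1⟩
  · subst hV
    rfl

theorem txValue_of_last {h : History Key Row Tx Ev} (hl : OrderLaws h) {t : Tx} {x : Key}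
    {e : Ev} {d : Datum Row} (hd : (buildTables h).val.last t x = some (e, d)) :
    h.TxValue t x d := by
  obtain ⟨value, hv, q, hq, heq⟩ := buildTables_last h t x
  rw [heq, Option.bind_eq_some_iff] at hd
  obtain ⟨w, hw, hd⟩ := hd
  obtain ⟨d', hd', hp⟩ := Option.map_eq_some_iff.1 hd
  cases hp
  obtain ⟨h1, h2, h3⟩ := (hq _).1 (List.find?_some hw)
  obtain ⟨h4, h5⟩ := (hv _ _).1 hd'
  refine ⟨e, h1, ⟨⟨_, h4⟩, h5⟩, fun w' hw' hev => ?_, h4⟩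
  by_cases hne : w' = e
  · exact Or.inl hne
  · obtain ⟨⟨d'', hd''⟩, hna⟩ := hev
    rcases hl.po_total w' e (by rw [hw', h1]) hne with hp | hp
    · exact Or.inr hp
    · exact absurd ⟨by simp [(hv w' d'').2 ⟨hd'', hna⟩], hp⟩ (h3 w')

/-- The finite nonempty set of events of `t` that write `x` has a `po`-last element, which passes
the test `q`, so the search succeeds. -/
theorem writes_of_txWrites {h : History Key Row Tx Ev} (hl : OrderLaws h) {t : Tx} {x : Key}
    (ht : h.TxWrites t x) : (buildTables h).val.writes t x = true := by
  obtain ⟨value, hv, q, hq, heq⟩ := buildTables_last h t x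
  obtain ⟨w, hw, ⟨d, hd⟩, hna⟩ := ht
  classical
  let S : Finset Ev := Finset.univ.filter fun e => h.tr e = t ∧ (value e).isSome = true
  have hwS : w ∈ S := by simp [S, hw, (hv w d).2 ⟨hd, hna⟩]
  -- The order is reversed, so a minimal element is a last event.
  let _ : IsTrans Ev (fun a b : Ev => h.po b a = true) :=
    ⟨fun a b c hab hbc => hl.po_trans c b a hbc hab⟩
  let _ : Std.Irrefl (fun a b : Ev => h.po b a = true) := ⟨fun a => hl.po_irrefl a⟩
  have wf : WellFounded (fun a b : Ev => h.po b a = true) :=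
    Finite.wellFounded_of_trans_of_irrefl _
  obtain ⟨m, hm, hmin⟩ := wf.has_min (S : Set Ev) ⟨w, hwS⟩
  have hm' : h.tr m = t ∧ (value m).isSome = true := by simpa [S] using hm
  have hqm : q m = true := by
    refine (hq m).2 ⟨hm'.1, hm'.2, fun e' he' => ?_⟩
    refine hmin e' ?_ he'.2
    simp only [S, Finset.coe_filter, Finset.mem_univ, true_and, Set.mem_ofPred_eq]
    exact ⟨by rw [← hl.po_tr _ _ he'.2, hm'.1], he'.1⟩
  obtain ⟨e, he⟩ : ∃ e, (FinEnum.toList Ev).find? q = some e := by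
    rw [← Option.isSome_iff_exists, List.find?_isSome]
    exact ⟨m, FinEnum.mem_toList m, hqm⟩
  have h2 := ((hq _).1 (List.find?_some he)).2.1
  obtain ⟨d', hd'⟩ := Option.isSome_iff_exists.1 h2
  simp [Tables.writes, heq, he, hd']

theorem buildTables_depEv {h : History Key Row Tx Ev} {t : Tx} {r : Ev} (hd : h.DepEv t r) :
    (buildTables h).val.depEv t r = true := by
  change (h.so t (h.tr r) || ((anyOf fun x =>
    op ((h.wrInv x r).any fun w => decide (h.tr w = t))).val && !decide (t = h.tr r))) = true
  rcases hd with hd | ⟨hne, x, w, hw, ht⟩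
  · simp [hd]
  · have : (anyOf fun x => op ((h.wrInv x r).any fun w => decide (h.tr w = t))).val = true := by
      rw [val_anyOf]
      refine ⟨x, ?_⟩
      rw [wr] at hw
      simp [hw, ht]
    simp [this, hne]

theorem buildTables_dep {h : History Key Row Tx Ev} {t₁ t₂ : Tx} (hd : h.Dep t₁ t₂) :
    (buildTables h).val.dep t₁ t₂ = true := by
  change (h.so t₁ t₂ || (anyOf fun r =>
    op (decide (h.tr r = t₂) && (buildTables h).val.depEv t₁ r)).val) = true
  rcases hd with hd | ⟨hne, x, w, r, hw, ht, hr⟩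
  · simp [hd]
  · have : (anyOf fun r =>
        op (decide (h.tr r = t₂) && (buildTables h).val.depEv t₁ r)).val = true := by
      rw [val_anyOf]
      refine ⟨r, ?_⟩
      simp [hr, buildTables_depEv (h := h) (Or.inr ⟨by rwa [hr], x, w, hw, ht⟩)]
    simp [this]

/-! ## Completeness of the computed partial commit order -/

theorem transClosure_of_rel {R : Tx → Tx → Bool} {a b : Tx} (hab : R a b = true) :
    (transClosure R).val a b = true :=
  forEach_keep (p := fun M : Tx → Tx → Bool => M a b = true)
    (fun k M hM => by simp [hM]) _ _ hab

/-- The invariant of Warshall's algorithm: the current relation is closed under composition through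
every midpoint in `D`, the set of midpoints already processed. A round for `c` adds `c` to `D` and
keeps closure through the old midpoints. -/
theorem transClosure_closed_through (l : List Tx) (M : Tx → Tx → Bool) (D : Tx → Prop)
    (hM : ∀ a b k, D k → M a k = true → M k b = true → M a b = true) :
    ∀ a b k, (D k ∨ k ∈ l) →
      (forEach (fun k M => tabulate fun a => tabulate fun b =>
        op (M a b || (M a k && M k b))) l M).val a k = true →
      (forEach (fun k M => tabulate fun a => tabulate fun b =>
        op (M a b || (M a k && M k b))) l M).val k b = true →
      (forEach (fun k M => tabulate fun a => tabulate fun b =>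
        op (M a b || (M a k && M k b))) l M).val a b = true := by
  induction l generalizing M D with
  | nil => intro a b k hk; exact hM a b k (by simpa using hk)
  | cons c l ih =>
    intro a b k hk
    refine ih _ (fun k => D k ∨ k = c) ?_ a b k (by simpa [or_assoc] using hk)
    intro a b k hk h1 h2
    simp only [val_op, val_tabulate, Bool.or_eq_true, Bool.and_eq_true] at h1 h2 ⊢
    rcases hk with hk | rfl
    · rcases h1 with h1 | ⟨h1, h1'⟩ <;> rcases h2 with h2 | ⟨h2, h2'⟩
      · exact Or.inl (hM _ _ _ hk h1 h2)
      · exact Or.inr ⟨hM _ _ _ hk h1 h2, h2'⟩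
      · exact Or.inr ⟨h1, hM _ _ _ hk h1' h2⟩
      · exact Or.inr ⟨h1, h2'⟩
    -- For the midpoint that is being processed, its own row and column do not change in the round,
    -- so both pairs were already in the old relation.
    · refine Or.inr ⟨?_, ?_⟩
      · rcases h1 with h1 | h1
        · exact h1
        · exact h1.1
      · rcases h2 with h2 | h2
        · exact h2
        · exact h2.2

theorem transClosure_of_transGen {R : Tx → Tx → Bool} {a b : Tx}
    (hab : Relation.TransGen (fun a b => R a b = true) a b) :
    (transClosure R).val a b = true := by
  induction hab with
  | single hab => exact transClosure_of_rel hab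
  | tail _ hbc ih =>
    exact transClosure_closed_through (FinEnum.toList Tx) R (fun _ => False)
      (fun _ _ _ hk => hk.elim) _ _ _ (Or.inr (FinEnum.mem_toList _)) ih
      (transClosure_of_rel hbc)

/-- This direction is the one that makes the computed relation contain `Pco`. It rests on the
completeness of the tables and of the transitive closure. -/
theorem evalVis_of_visible {h : History Key Row Tx Ev} (hl : OrderLaws h)
    {R : Tx → Tx → Bool} {t₂ : Tx} {r : Ev} {v : Vis}
    (hv : h.Visible (fun a b => R a b = true) t₂ r v) :
    (evalVis h (buildTables h).val R (transClosure R).val t₂ r v).val = true := by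
  have refl : ∀ t₄, Relation.ReflTransGen (fun a b => R a b = true) t₂ t₄ →
      (decide (t₂ = t₄) || (transClosure R).val t₂ t₄) = true := by
    intro t₄ ht
    rcases Relation.reflTransGen_iff_eq_or_transGen.1 ht with ht | ht
    · simp [ht]
    · simp [transClosure_of_transGen ht]
  cases v with
  | readCommitted =>
    obtain ⟨r', h1, h2⟩ := hv
    rw [evalVis, val_anyOf]
    exact ⟨r', by simpa [buildTables_depEv h1] using h2⟩
  | readAtomic => exact buildTables_dep hv
  | serializability => exact hv
  | prefixVis =>
    obtain ⟨t₄, h1, h2⟩ := hv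
    rw [evalVis, val_anyOf]
    exact ⟨t₄, by rw [val_op, refl _ h1, buildTables_dep h2]; rfl⟩
  | conflict =>
    obtain ⟨t₄, y, h1, h2, h3, h4⟩ := hv
    rw [evalVis, val_anyOf]
    refine ⟨t₄, ?_⟩
    rw [val_anyOf]
    refine ⟨y, ?_⟩
    rw [val_op, refl _ h3, writes_of_txWrites hl h1, writes_of_txWrites hl h2, h4]
    rfl

theorem saturate_keep {h : History Key Row Tx Ev} {R : Tx → Tx → Bool} {a b : Tx}
    (hab : R a b = true) : (saturate h R).val a b = true := by
  unfold saturate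
  simp only [val_bind]
  refine forEach_keep (p := fun M : Tx → Tx → Bool => M a b = true) ?_ _ _ hab
  intro x M hM
  refine forEach_keep (p := fun M : Tx → Tx → Bool => M a b = true) ?_ _ _ hM
  intro r M hM
  cases h.wrInv x r with
  | none => exact hM
  | some w =>
    dsimp only
    split
    · refine forEach_keep (p := fun M : Tx → Tx → Bool => M a b = true) ?_ _ _ hM
      intro t M hM
      split
      · refine forEach_keep (p := fun M : Tx → Tx → Bool => M a b = true) ?_ _ _ hM
        intro v M hM
        simp [hM]
      · exact hM
    · exact hM

/-- The iteration for the witnesses `x`, `r`, `a`, `v` adds the pair, and all other iterations keep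
it. Visibility is evaluated with the input relation and not with the growing result, exactly as in
`Saturate`. -/
theorem saturate_complete {h : History Key Row Tx Ev} (hl : OrderLaws h)
    {R : Tx → Tx → Bool} {a b : Tx} (hab : h.Saturate (fun a b => R a b = true) a b) :
    (saturate h R).val a b = true := by
  rcases hab with hab | ⟨x, r, w, hr, hne, hwx, hw, rfl, hne', v, hv, hvis⟩
  · exact saturate_keep hab
  unfold saturate
  simp only [val_bind]
  have keep₃ : ∀ (c : Tx) (x : Key) (r w' : Ev) (M : Tx → Tx → Bool), M a c = true →
      (forEach (fun (t₂ : Tx) res₃ =>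
            if decide (t₂ ≠ h.tr r) && (buildTables h).val.writes t₂ x &&
                decide (t₂ ≠ h.tr w') then
              forEach (fun (v : Vis) res₄ => do
                let b ← evalVis h (buildTables h).val R (transClosure R).val t₂ r v
                op (fun s t => (b && decide (s = t₂ ∧ t = h.tr w')) || res₄ s t))
                (h.iso (h.tr r)).visSet res₃
            else op res₃)
            (FinEnum.toList Tx) M).val a c = true := by
    intro c x r w' M hM
    refine forEach_keep (p := fun M : Tx → Tx → Bool => M a c = true) ?_ _ _ hM
    intro t M hM
    split
    · refine forEach_keep (p := fun M : Tx → Tx → Bool => M a c = true) ?_ _ _ hM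
      intro v M hM
      simp [hM]
    · exact hM
  have keep₂ : ∀ (c : Tx) (x : Key) (r : Ev) (M : Tx → Tx → Bool), M a c = true →
      (match h.wrInv x r with
      | none => op M
      | some w' =>
        if (h.kind r).isRead then
          forEach (fun (t₂ : Tx) res₃ =>
            if decide (t₂ ≠ h.tr r) && (buildTables h).val.writes t₂ x &&
                decide (t₂ ≠ h.tr w') then
              forEach (fun (v : Vis) res₄ => do
                let b ← evalVis h (buildTables h).val R (transClosure R).val t₂ r v
                op (fun s t => (b && decide (s = t₂ ∧ t = h.tr w')) || res₄ s t))
                (h.iso (h.tr r)).visSet res₃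
            else op res₃)
            (FinEnum.toList Tx) M
        else op M).val a c = true := by
    intro c x r M hM
    cases h.wrInv x r with
    | none => exact hM
    | some w =>
      dsimp only
      split
      · exact keep₃ c x r w M hM
      · exact hM
  refine forEach_of_mem (p := fun M : Tx → Tx → Bool => M a (h.tr w) = true) ?_
    (FinEnum.mem_toList x) ?_ _
  · intro x M hM
    exact forEach_keep (p := fun M : Tx → Tx → Bool => M a (h.tr w) = true)
      (fun r M hM => keep₂ _ x r M hM) _ _ hM
  intro M
  refine forEach_of_mem (p := fun M : Tx → Tx → Bool => M a (h.tr w) = true)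
    (fun r M hM => keep₂ _ x r M hM) (FinEnum.mem_toList r) ?_ _
  intro M
  rw [wr] at hw
  rw [IsReadOp] at hr
  simp only [hw, hr, if_true]
  refine forEach_of_mem (p := fun M : Tx → Tx → Bool => M a (h.tr w) = true) ?_
    (FinEnum.mem_toList a) ?_ _
  · intro t M hM
    split
    · refine forEach_keep (p := fun M : Tx → Tx → Bool => M a (h.tr w) = true) ?_ _ _ hM
      intro v M hM
      simp [hM]
    · exact hM
  intro M
  rw [if_pos (by simp [hne, hne', writes_of_txWrites hl hwx])]
  refine forEach_of_mem (p := fun M : Tx → Tx → Bool => M a (h.tr w) = true) ?_ hv ?_ _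
  · intro v M hM
    simp [hM]
  · intro M
    simp [evalVis_of_visible hl hvis]

theorem iterSaturate_keep {h : History Key Row Tx Ev} (n : ℕ) {R : Tx → Tx → Bool} {a b : Tx}
    (hab : R a b = true) : (iterSaturate h n R).val a b = true := by
  induction n generalizing R with
  | zero => exact hab
  | succ n ih =>
    simp only [iterSaturate, val_bind]
    split
    · exact saturate_keep hab
    · exact ih (saturate_keep hab)

/-- A round that changes the relation adds at least one of the `|T|²` pairs. So the sum of the
remaining rounds and the present pairs never decreases and stays above `|T|²`; the fuel cannot run
out before a round changes nothing, and then the relation is closed. -/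
theorem iterSaturate_closed {h : History Key Row Tx Ev} (hl : OrderLaws h) (n : ℕ)
    (R : Tx → Tx → Bool)
    (hn : Fintype.card Tx ^ 2 <
      n + (Finset.univ.filter fun p : Tx × Tx => R p.1 p.2 = true).card) {a b : Tx}
    (hab : h.Saturate (fun a b => (iterSaturate h n R).val a b = true) a b) :
    (iterSaturate h n R).val a b = true := by
  induction n generalizing R with
  | zero =>
    exfalso
    have := Finset.card_le_univ (Finset.univ.filter fun p : Tx × Tx => R p.1 p.2 = true)
    rw [Fintype.card_prod, ← sq] at this
    omega
  | succ n ih =>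
    simp only [iterSaturate, val_bind] at hab ⊢
    split at hab
    · rename_i hs
      rw [if_pos hs]
      simp only [val_allOf, val_op, beq_iff_eq] at hs
      have heq : (saturate h R).val = R := by
        funext a b; exact (hs a b).symm
      rw [val_op]
      simp only [val_op, heq] at hab
      exact saturate_complete hl hab
    · rename_i hs
      rw [if_neg hs]
      refine ih _ ?_ hab
      simp only [val_allOf, val_op, beq_iff_eq, not_forall] at hs
      obtain ⟨c, d, hcd⟩ := hs
      have : (Finset.univ.filter fun p : Tx × Tx => R p.1 p.2 = true).card <
          (Finset.univ.filter fun p : Tx × Tx => (saturate h R).val p.1 p.2 = true).card := by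
        refine Finset.card_lt_card (Finset.ssubset_iff_of_subset ?_ |>.2 ⟨(c, d), ?_, ?_⟩)
        · intro p hp
          simp only [Finset.mem_filter, Finset.mem_univ, true_and] at hp ⊢
          exact saturate_keep hp
        · simp only [Finset.mem_filter, Finset.mem_univ, true_and]
          cases h1 : R c d with
          | true => exact saturate_keep h1
          | false => rw [h1] at hcd; cases h2 : (saturate h R).val c d with
            | true => rfl
            | false => exact absurd h2.symm hcd
        · simp only [Finset.mem_filter, Finset.mem_univ, true_and]
          intro h1
          exact hcd (h1.trans (saturate_keep h1).symm)
      omega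

theorem computePco_of_so {h : History Key Row Tx Ev} {a b : Tx} (hab : h.so a b = true) :
    (computePco h).val a b = true := by
  change (iterSaturate h (Fintype.card Tx ^ 2 + 1)
    (transClosure (buildTables h).val.dep).val).val a b = true
  exact iterSaturate_keep _ (transClosure_of_rel (buildTables_dep (Or.inl hab)))

theorem computePco_of_pco {h : History Key Row Tx Ev} (hl : OrderLaws h) {a b : Tx}
    (hab : h.Pco a b) : (computePco h).val a b = true := by
  change (iterSaturate h (Fintype.card Tx ^ 2 + 1)
    (transClosure (buildTables h).val.dep).val).val a b = true
  -- `Pco` is contained in every closed relation above `(so ∪ wr)⁺`; it is instantiated with the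
  -- computed one.
  refine hab (fun a b => (iterSaturate h (Fintype.card Tx ^ 2 + 1)
    (transClosure (buildTables h).val.dep).val).val a b = true) (fun s t hst => ?_) (fun s t hst => iterSaturate_closed hl _ _ (by omega) hst)
  exact iterSaturate_keep _ (transClosure_of_transGen (Relation.TransGen.mono (fun _ _ => buildTables_dep) _ _ hst))

/-- The test for missing predecessors uses the computed `pco`, which contains `so`. It is the part
of consistency that keeps `T_P` closed under `so`-predecessors. -/
theorem isConsistentExtension_so {test : ConflictTest} {h : History Key Row Tx Ev}
    {P : Committed Key Tx} {t : Tx} (ht : (isConsistentExtension test h P t).val = true) {s : Tx}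
    (hs : h.so s t = true) : P.mem s = true := by
  by_contra hP
  have : (anyOf fun t' => op (!P.mem t' && (computePco h).val t' t)).val = true := by
    rw [val_anyOf]
    exact ⟨s, by simp [hP, computePco_of_so hs]⟩
  simp only [isConsistentExtension, val_bind] at ht
  rw [if_pos this] at ht
  cases ht

end History

/-! ### Weakening of cost bounds to a common constant and exponent. -/

namespace Timed

variable {α β σ ι : Type}

theorem pow_mono_cost {c n C k C' k' : ℕ} (hn : 1 ≤ n) (h : c ≤ C * n ^ k) (hC : C ≤ C')
    (hk : k ≤ k') : c ≤ C' * n ^ k' :=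
  h.trans (Nat.mul_le_mul hC (Nat.pow_le_pow_right hn hk))

theorem one_le_cost {n C k : ℕ} (hn : 1 ≤ n) (hC : 1 ≤ C) : 1 ≤ C * n ^ k :=
  Nat.one_le_iff_ne_zero.2 (Nat.mul_ne_zero (by omega) (pow_ne_zero _ (by omega)))

end Timed

namespace History

variable {Key Row Tx Ev : Type} [FinEnum Key] [FinEnum Tx] [FinEnum Ev]

/-! ## Running times, in terms of a bound on the numbers of keys, transactions and events -/

theorem cost_evalValue_le (h : History Key Row Tx Ev) (x : Key) (n : ℕ) (w : Ev) :
    (h.evalValue x n w).cost ≤ 2 * n + 1 := by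
  induction n generalizing w with
  | zero => simp [evalValue]
  | succ n ih =>
    rw [evalValue]
    split
    · simp
    · simp only [cost_bind, cost_op, val_op]
      cases h.wrInv x w with
      | none => simp only [cost_op]; omega
      | some w' =>
        have := ih w'
        simp only [cost_bind, cost_op]; omega
    · simp only [cost_bind, cost_op, val_op]
      cases h.wrInv x w with
      | none => simp only [cost_op]; omega
      | some w' =>
        have := ih w'
        simp only [cost_bind, cost_op]; omega
    · simp

/-- A number that bounds the numbers of keys, transactions and events. -/
structure SizeBound (Key Tx Ev : Type) [FinEnum Key] [FinEnum Tx] [FinEnum Ev] (n : ℕ) :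
    Prop where
  pos : 1 ≤ n
  key : Fintype.card Key ≤ n
  tx : Fintype.card Tx ≤ n
  ev : Fintype.card Ev ≤ n

/-- The largest term is the table `last`: four nested loops, over a transaction, a key, a candidate
event and a possible later event. The other tables need three levels, with `evalValue` counting as
one because it follows a chain of at most `|Ev|` reads. -/
theorem cost_buildTables_le (h : History Key Row Tx Ev) {n : ℕ} (hn : SizeBound Key Tx Ev n) :
    (buildTables h).cost ≤ 40 * n ^ 4 := by
  have p := hn.pos
  unfold buildTables
  simp only [cost_bind, cost_op]
  have op1 : ∀ {α : Type} (a : α), (op a).cost ≤ 1 * n ^ 0 := by simp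
  have h1 := cost_tabulate_le p hn.tx (fun t : Tx => cost_anyOf_le p hn.ev fun e : Ev =>
    op1 (decide (h.tr e = t) && (h.kind e).isAbort))
  set ab := tabulate fun t => anyOf fun e => op (decide (h.tr e = t) && (h.kind e).isAbort)
  have h2 := cost_tabulate_le (f := fun (e : Ev) => tabulate fun (x : Key) =>
    if (h.kind e).isWrite && !ab.val (h.tr e) then evalValue h x (Fintype.card Ev) e
      else op none) (C := 5) (k := 2) p hn.ev fun e =>
        cost_tabulate_le (C := 3) (k := 1) p hn.key fun x => by
        split
        · refine (cost_evalValue_le h x _ e).trans ?_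
          have := hn.ev
          rw [pow_one]
          omega
        · exact one_le_cost p (by norm_num)
  set value := tabulate fun (e : Ev) => tabulate fun (x : Key) =>
    if (h.kind e).isWrite && !ab.val (h.tr e) then evalValue h x (Fintype.card Ev) e
      else op none
  have h3 := cost_tabulate_le (f := fun (t : Tx) => tabulate fun (x : Key) => do
    let w ← findOf fun e =>
      if decide (h.tr e = t) && (value.val e x).isSome then
        allOf fun e' => op (!((value.val e' x).isSome && h.po e e'))
      else op false
    op (w.bind fun e => (value.val e x).map fun d => (e, d))) (C := 8) (k := 3) p hn.tx fun t =>
      cost_tabulate_le (C := 6) (k := 2) p hn.key fun x => by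
        simp only [cost_bind, cost_op]
        have := cost_findOf_le (f := fun e => if decide (h.tr e = t) && (value.val e x).isSome then
            allOf fun e' => op (!((value.val e' x).isSome && h.po e e'))
          else op false) (C := 3) (k := 1) p hn.ev fun e => by
            split
            · exact cost_allOf_le p hn.ev fun e' => op1 _
            · exact one_le_cost p (by norm_num)
        norm_num at this ⊢
        have := one_le_cost (n := n) (C := 1) (k := 2) p le_rfl
        omega
  set last := tabulate fun (t : Tx) => tabulate fun (x : Key) => do
    let w ← findOf fun e =>
      if decide (h.tr e = t) && (value.val e x).isSome then
        allOf fun e' => op (!((value.val e' x).isSome && h.po e e'))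
      else op false
    op (w.bind fun e => (value.val e x).map fun d => (e, d))
  have h4 := cost_tabulate_le (f := fun (t : Tx) => tabulate fun (r : Ev) => do
    let b ← anyOf fun x => op ((h.wrInv x r).any fun w => decide (h.tr w = t))
    op (h.so t (h.tr r) || (b && !decide (t = h.tr r)))) (C := 6) (k := 2) p hn.tx fun t =>
      cost_tabulate_le (C := 4) (k := 1) p hn.ev fun r => by
        simp only [cost_bind, cost_op]
        have := cost_anyOf_le p hn.key fun x =>
          op1 ((h.wrInv x r).any fun w => decide (h.tr w = t))
        simp only [zero_add, pow_one] at this ⊢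
        omega
  set depEv := tabulate fun (t : Tx) => tabulate fun (r : Ev) => do
    let b ← anyOf fun x => op ((h.wrInv x r).any fun w => decide (h.tr w = t))
    op (h.so t (h.tr r) || (b && !decide (t = h.tr r)))
  have h5 := cost_tabulate_le (f := fun (t₁ : Tx) => tabulate fun (t₂ : Tx) => do
    let b ← anyOf fun r => op (decide (h.tr r = t₂) && depEv.val t₁ r)
    op (h.so t₁ t₂ || b)) (C := 6) (k := 2) p hn.tx fun t₁ =>
      cost_tabulate_le (C := 4) (k := 1) p hn.tx fun t₂ => by
        simp only [cost_bind, cost_op]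
        have := cost_anyOf_le p hn.ev fun r => op1 (decide (h.tr r = t₂) && depEv.val t₁ r)
        simp only [zero_add, pow_one] at this ⊢
        omega
  have h1 := pow_mono_cost p h1 (C' := 5) (k' := 4) (by norm_num) (by norm_num)
  have h2 := pow_mono_cost p h2 (C' := 7) (k' := 4) (by norm_num) (by norm_num)
  have h4 := pow_mono_cost p h4 (C' := 8) (k' := 4) (by norm_num) (by norm_num)
  have h5 := pow_mono_cost p h5 (C' := 8) (k' := 4) (by norm_num) (by norm_num)
  have := one_le_cost (n := n) (C := 1) (k := 4) p le_rfl
  norm_num at h1 h2 h3 h4 h5 this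
  omega

theorem cost_transClosure_le (R : Tx → Tx → Bool) {n : ℕ} (hn : SizeBound Key Tx Ev n) :
    (transClosure R).cost ≤ 7 * n ^ 3 :=
  cost_forEach_le hn.pos (length_toList.trans_le hn.tx)
    (fun k _ M => cost_tabulate_le hn.pos hn.tx fun a => cost_tabulate_le (C := 1) (k := 0)
      hn.pos hn.tx fun b => by simp) R

/-- The exponent of the running time of the evaluation of a visibility relation: `1` suffices if
no transaction uses snapshot isolation. -/
structure VisExponent (h : History Key Row Tx Ev) (e : ℕ) : Prop where
  pos : 1 ≤ e
  two_le : ∀ t, h.iso t = .SI → 2 ≤ e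

theorem length_visSet_le (l : IsoLevel) : l.visSet.length ≤ 2 := by
  cases l <;> simp [IsoLevel.visSet]

/-- Only `conflict` needs two nested loops, over `t₄` and `y`, and it occurs only in the visibility
set of SI. The hypothesis on `v` makes this available, so `e = 1` is possible without SI. -/
theorem cost_evalVis_le {h : History Key Row Tx Ev} {n e : ℕ} (hn : SizeBound Key Tx Ev n)
    (he : VisExponent h e) (tb : Tables Key Row Tx Ev) (R S : Tx → Tx → Bool) (t₂ : Tx) (r : Ev)
    {t : Tx} {v : Vis} (hv : v ∈ (h.iso t).visSet) :
    (evalVis h tb R S t₂ r v).cost ≤ 5 * n ^ e := by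
  have op1 : ∀ {α : Type} (a : α), (op a).cost ≤ 1 * n ^ 0 := by simp
  cases v with
  | readCommitted =>
    exact pow_mono_cost hn.pos (cost_anyOf_le hn.pos hn.ev fun _ => op1 _) (by norm_num) he.pos
  | readAtomic => exact one_le_cost hn.pos (by norm_num)
  | serializability => exact one_le_cost hn.pos (by norm_num)
  | prefixVis =>
    exact pow_mono_cost hn.pos (cost_anyOf_le hn.pos hn.tx fun _ => op1 _) (by norm_num) he.pos
  | conflict =>
    have : h.iso t = .SI := by
      revert hv
      cases h.iso t <;> simp [IsoLevel.visSet]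
    exact pow_mono_cost hn.pos (cost_anyOf_le hn.pos hn.tx fun _ =>
      cost_anyOf_le hn.pos hn.key fun _ => op1 _) (by norm_num) (he.two_le t this)

/-- A loop over the visibility relations of an isolation level. -/
theorem cost_forEach_visSet_le {σ : Type} {l : IsoLevel} {body : Vis → σ → Timed σ} {n C k : ℕ}
    (hn : 1 ≤ n) (hb : ∀ v ∈ l.visSet, ∀ s, (body v s).cost ≤ C * n ^ k) (s : σ) :
    (forEach body l.visSet s).cost ≤ (2 * C + 3) * n ^ k := by
  have h1 := cost_forEach_le' hb s
  have h2 := length_visSet_le l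
  have h3 : 1 ≤ n ^ k := Nat.one_le_pow _ _ hn
  calc _ ≤ 1 + 2 * (C * n ^ k + 1) := h1.trans (by gcongr)
    _ ≤ _ := by linarith

/-- Three loops, over keys, events and transactions, surround a visibility test of cost `n ^ e`. The
auxiliary tables cost `n ^ 4`, which is absorbed since `e ≥ 1`. -/
theorem cost_saturate_le {h : History Key Row Tx Ev} {n e : ℕ} (hn : SizeBound Key Tx Ev n)
    (he : VisExponent h e) (R : Tx → Tx → Bool) : (saturate h R).cost ≤ 80 * n ^ (e + 3) := by
  have p := hn.pos
  have q := he.pos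
  unfold saturate
  simp only [cost_bind]
  have h1 := pow_mono_cost p (cost_buildTables_le h hn) (C' := 40) (k' := e + 3) le_rfl (by omega)
  have h2 := pow_mono_cost p (cost_transClosure_le (Key := Key) (Ev := Ev) R hn) (C' := 7)
    (k' := e + 3) le_rfl (by omega)
  have h3 := pow_mono_cost p (cost_tabulate_le p hn.tx fun a : Tx =>
    cost_tabulate_le (C := 1) (k := 0) p hn.tx fun b : Tx => (cost_op (R a b)).trans_le (by simp))
    (C' := 5) (k' := e + 3) (by norm_num) (by omega)
  refine (add_le_add h1 (add_le_add h2 (add_le_add h3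
    (cost_forEach_le (C := 19) (k := e + 2) p (length_toList.trans_le hn.key) ?_ _)))).trans
    (by rw [show e + 2 + 1 = e + 3 by ring]; linarith [Nat.zero_le (n ^ (e + 3))])
  intro x _ M
  refine cost_forEach_le (C := 17) (k := e + 1) p (length_toList.trans_le hn.ev) ?_ _
  intro r _ M
  cases h.wrInv x r with
  | none => exact one_le_cost p (by norm_num)
  | some w =>
    dsimp only
    split
    · refine cost_forEach_le (C := 15) (k := e) p (length_toList.trans_le hn.tx) ?_ _
      intro t _ M
      split
      · refine cost_forEach_visSet_le (C := 6) p ?_ _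
        intro v hv M
        simp only [cost_bind, cost_op]
        have := cost_evalVis_le hn he (buildTables h).val R (transClosure R).val t r hv
        have := one_le_cost (n := n) (C := 1) (k := e) p le_rfl
        omega
      · exact one_le_cost p (by norm_num)
    · exact one_le_cost p (by norm_num)

theorem cost_iterSaturate_le {h : History Key Row Tx Ev} {n e : ℕ} (hn : SizeBound Key Tx Ev n)
    (he : VisExponent h e) (m : ℕ) (R : Tx → Tx → Bool) :
    (iterSaturate h m R).cost ≤ 1 + m * (86 * n ^ (e + 3)) := by
  have p := hn.pos
  induction m generalizing R with
  | zero => simp [iterSaturate]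
  | succ m ih =>
    simp only [iterSaturate, cost_bind]
    have h1 := cost_saturate_le hn he R
    have h2 := pow_mono_cost p (cost_allOf_le p hn.tx fun a : Tx =>
      cost_allOf_le (C := 1) (k := 0) p hn.tx fun b : Tx =>
        (cost_op (R a b == (saturate h R).val a b)).trans_le (by simp))
      (C' := 5) (k' := e + 3) (by norm_num) (by omega)
    have h3 := ih (saturate h R).val
    have := one_le_cost (n := n) (C := 1) (k := e + 3) p le_rfl
    split
    · simp only [cost_op]
      nlinarith [Nat.zero_le (m * n ^ (e + 3))]
    · nlinarith

theorem cost_computePco_le {h : History Key Row Tx Ev} {n e : ℕ} (hn : SizeBound Key Tx Ev n)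
    (he : VisExponent h e) : (computePco h).cost ≤ 220 * n ^ (e + 5) := by
  have p := hn.pos
  unfold computePco
  simp only [cost_bind]
  have h1 := pow_mono_cost p (cost_buildTables_le h hn) (C' := 40) (k' := e + 5) le_rfl
    (by have := he.pos; omega)
  have h2 := pow_mono_cost p (cost_transClosure_le (Key := Key) (Ev := Ev)
    (buildTables h).val.dep hn) (C' := 7) (k' := e + 5) le_rfl (by omega)
  have h3 := cost_iterSaturate_le hn he (Fintype.card Tx ^ 2 + 1)
    (transClosure (buildTables h).val.dep).val
  have h4 : Fintype.card Tx ^ 2 + 1 ≤ 2 * n ^ 2 := by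
    have := Nat.pow_le_pow_left hn.tx 2
    have := one_le_cost (n := n) (C := 1) (k := 2) p le_rfl
    omega
  have h5 : (Fintype.card Tx ^ 2 + 1) * (86 * n ^ (e + 3)) ≤ 172 * n ^ (e + 5) :=
    (Nat.mul_le_mul_right _ h4).trans (le_of_eq (by ring))
  have := one_le_cost (n := n) (C := 1) (k := e + 5) p le_rfl
  omega

theorem cost_isCyclic_le (R : Tx → Tx → Bool) {n : ℕ} (hn : SizeBound Key Tx Ev n) :
    (isCyclic R).cost ≤ 10 * n ^ 3 := by
  unfold isCyclic
  simp only [cost_bind]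
  have h1 := cost_transClosure_le (Key := Key) (Ev := Ev) R hn
  have h2 := pow_mono_cost hn.pos (cost_anyOf_le (C := 1) (k := 0) hn.pos hn.tx fun t : Tx =>
    (cost_op ((transClosure R).val t t)).trans_le (by simp)) (C' := 3) (k' := 3) (by norm_num)
    (by omega)
  omega

theorem cost_emptyCommitted_le {n : ℕ} (hn : SizeBound Key Tx Ev n) :
    (emptyCommitted : Timed (Committed Key Tx)).cost ≤ 7 * n := by
  unfold emptyCommitted
  simp only [cost_bind, cost_op]
  have h1 := cost_tabulate_le (C := 1) (k := 0) hn.pos hn.tx fun _ : Tx =>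
    (cost_op false).trans_le (by simp)
  have h2 := cost_tabulate_le (C := 1) (k := 0) hn.pos hn.key fun _ : Key =>
    (cost_op (none : Option Tx)).trans_le (by simp)
  have := hn.pos
  simp only [zero_add, pow_one] at h1 h2
  omega

theorem cost_extend_le (h : History Key Row Tx Ev) {n : ℕ} (hn : SizeBound Key Tx Ev n)
    (P : Committed Key Tx) (t : Tx) : (extend h P t).cost ≤ 47 * n ^ 4 := by
  unfold extend
  simp only [cost_bind, cost_op]
  have h0 := cost_buildTables_le h hn
  have h1 := pow_mono_cost hn.pos (cost_tabulate_le (C := 1) (k := 0) hn.pos hn.tx fun s : Tx =>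
    (cost_op (P.mem s || decide (s = t))).trans_le (by simp)) (C' := 3) (k' := 4) (by norm_num)
    (by omega)
  have h2 := pow_mono_cost hn.pos (cost_tabulate_le (C := 1) (k := 0) hn.pos hn.key
    fun x : Key => (cost_op (if (buildTables h).val.writes t x then some t
      else P.last x)).trans_le (by simp)) (C' := 3) (k' := 4) (by norm_num) (by omega)
  have := one_le_cost (n := n) (C := 1) (k := 4) hn.pos le_rfl
  omega

theorem cost_visCons_le (test : ConflictTest) {h : History Key Row Tx Ev} {n e : ℕ}
    (hn : SizeBound Key Tx Ev n) (he : VisExponent h e) (tb : Tables Key Row Tx Ev)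
    (R S : Tx → Tx → Bool) (P : Committed Key Tx) (t : Tx) (r : Ev) {s : Tx} {v : Vis}
    (hv : v ∈ (h.iso s).visSet) :
    (visCons test h tb R S P t r v).cost ≤ 10 * n ^ (e + 2) := by
  have p := hn.pos
  unfold visCons
  simp only [cost_bind, cost_op]
  have := one_le_cost (n := n) (C := 1) (k := e + 2) p le_rfl
  suffices H : _ ≤ 9 * n ^ (e + 1 + 1) from
    (Nat.add_le_add_right H 1).trans (by rw [show e + 1 + 1 = e + 2 by ring]; omega)
  refine cost_anyOf_le (C := 7) p hn.key fun x => ?_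
  cases h.wrInv x r with
  | none => exact one_le_cost p (by norm_num)
  | some w =>
    dsimp only
    split
    · refine cost_anyOf_le (C := 5) p hn.tx fun t' => ?_
      split
      · exact cost_evalVis_le hn he tb R S t' r hv
      · exact one_le_cost p (by norm_num)
    · split
      · exact pow_mono_cost p (cost_evalVis_le hn he tb R S t r hv) (by norm_num) (by omega)
      · exact one_le_cost p (by norm_num)

/-- Recomputing `pco` dominates. The tests for all reads together are of order `n ^ (e + 3)`. -/
theorem cost_isConsistentExtension_le (test : ConflictTest) {h : History Key Row Tx Ev} {n e : ℕ}
    (hn : SizeBound Key Tx Ev n) (he : VisExponent h e) (P : Committed Key Tx) (t : Tx) :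
    (isConsistentExtension test h P t).cost ≤ 310 * n ^ (e + 5) := by
  have p := hn.pos
  have q := he.pos
  unfold isConsistentExtension
  simp only [cost_bind]
  have h0 := cost_computePco_le hn he
  have h1 := pow_mono_cost p (cost_anyOf_le (C := 1) (k := 0) p hn.tx fun t' : Tx =>
    (cost_op (!P.mem t' && (computePco h).val t' t)).trans_le (by simp)) (C' := 3) (k' := e + 5)
    (by norm_num) (by omega)
  have h5 := one_le_cost (n := n) (C := 1) (k := e + 5) p le_rfl
  split
  · simp only [cost_op]; omega
  · simp only [cost_bind]
    have h2 := pow_mono_cost p (cost_buildTables_le h hn) (C' := 40) (k' := e + 5) le_rfl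
      (by omega)
    have h3 := pow_mono_cost p (cost_tabulate_le p hn.tx fun a : Tx =>
      cost_tabulate_le (C := 1) (k := 0) p hn.tx fun b : Tx =>
        (cost_op ((computePco h).val a b || (P.mem a && decide (b = t)) ||
          (decide (a = t) && !P.mem b && !decide (b = t)))).trans_le (by simp))
      (C' := 5) (k' := e + 5) (by norm_num) (by omega)
    set R := tabulate fun a : Tx => tabulate fun b : Tx =>
      op ((computePco h).val a b || (P.mem a && decide (b = t)) ||
          (decide (a = t) && !P.mem b && !decide (b = t)))
    have h4 := pow_mono_cost p (cost_transClosure_le (Key := Key) (Ev := Ev) R.val hn) (C' := 7)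
      (k' := e + 5) le_rfl (by omega)
    have h6 := cost_allOf_le (f := fun r => if (h.kind r).isRead && !P.mem (h.tr r) &&
        !decide (h.tr r = t) then
        forEach (fun v ok => do
          let b ← visCons test h (buildTables h).val R.val (transClosure R.val).val P t r v
          op (ok && b))
          (h.iso (h.tr r)).visSet true
      else op true) (C := 25) (k := e + 2) p hn.ev fun r => by
        split
        · refine cost_forEach_visSet_le (C := 11) p ?_ _
          intro v hv ok
          simp only [cost_bind, cost_op]
          have := cost_visCons_le test hn he (buildTables h).val R.val (transClosure R.val).val
            P t r hv
          have := one_le_cost (n := n) (C := 1) (k := e + 2) p le_rfl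
          omega
        · exact one_le_cost p (by norm_num)
    have h6 := pow_mono_cost p h6 (C' := 27) (k' := e + 5) (by norm_num) (by omega)
    omega

theorem length_toList_code_le {n : ℕ} (hn : SizeBound Key Tx Ev n) :
    (FinEnum.toList (Tx ⊕ Key × Tx)).length ≤ 2 * n ^ 2 := by
  rw [length_toList, Fintype.card_eq_nat_card, Nat.card_sum, Nat.card_prod, Nat.card_eq_fintype_card,
    Nat.card_eq_fintype_card]
  have h1 := hn.key
  have h2 := hn.tx
  have h3 := hn.pos
  nlinarith [Nat.mul_le_mul h1 h2]

theorem length_encode_le (h : History Key Row Tx Ev) {n : ℕ} (hn : SizeBound Key Tx Ev n)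
    (P : Committed Key Tx) : (encode h P).val.length ≤ 2 * n ^ 2 := by
  unfold encode
  simp only [val_bind]
  split
  · rw [val_mapList, List.length_map]
    exact length_toList_code_le hn
  · rw [val_mapList, List.length_map, length_toList]
    have := hn.tx
    have := hn.pos
    nlinarith

theorem cost_encode_le (h : History Key Row Tx Ev) {n : ℕ} (hn : SizeBound Key Tx Ev n)
    (P : Committed Key Tx) : (encode h P).cost ≤ 8 * n ^ 2 := by
  have p := hn.pos
  unfold encode
  simp only [cost_bind]
  have h1 := pow_mono_cost p (cost_anyOf_le (C := 1) (k := 0) p hn.tx fun t : Tx =>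
    (cost_op (decide (h.iso t = .SI))).trans_le (by simp)) (C' := 3) (k' := 2) (by norm_num)
    (by omega)
  have h2 := one_le_cost (n := n) (C := 1) (k := 2) p le_rfl
  split
  · refine (Nat.add_le_add h1 (cost_mapList_le' (c := 1)
      (by rintro (t | ⟨x, t⟩) _ <;> simp))).trans ?_
    have := length_toList_code_le hn
    omega
  · have h3 := cost_mapList_le' (f := fun t : Tx => op (P.mem t)) (c := 1)
      (l := FinEnum.toList Tx) (by simp)
    rw [length_toList] at h3
    have := hn.tx
    have : n ≤ n ^ 2 := by nlinarith
    omega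

end History

namespace History

variable {Key Row Tx Ev : Type} [FinEnum Key] [FinEnum Tx] [FinEnum Ev]

/-! ## Counting the prefixes that the exploration can reach -/

theorem card_le_width (h : History Key Row Tx Ev) {A : Finset Tx}
    (hA : ∀ a ∈ A, ∀ b ∈ A, ¬ h.so a b = true) : A.card ≤ h.width := by
  classical
  unfold width
  refine Finset.le_sup (f := Finset.card) ?_
  rw [Finset.mem_filter]
  exact ⟨Finset.mem_univ _, fun a ha b hb _ hab => hA a ha b hb hab⟩

theorem one_le_width {h : History Key Row Tx Ev} (hl : OrderLaws h) : 1 ≤ h.width := by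
  have := h.card_le_width (A := {h.init}) (by
    intro a ha b hb
    rw [Finset.mem_singleton] at ha hb
    rw [ha, hb]
    exact hl.so_irrefl _)
  simpa using this

/-- Every element of a set of transactions lies below a maximal one. -/
theorem exists_maximal_above {h : History Key Row Tx Ev} (hl : OrderLaws h) (m : Tx → Prop)
    {t : Tx} (ht : m t) :
    ∃ s, m s ∧ (∀ s', m s' → ¬ h.so s s' = true) ∧ (t = s ∨ h.so t s = true) := by
  let _ : Std.Irrefl (fun a b : Tx => h.so b a = true) := ⟨fun a => hl.so_irrefl a⟩
  let _ : IsTrans Tx (fun a b : Tx => h.so b a = true) :=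
    ⟨fun a b c hab hbc => hl.so_trans c b a hbc hab⟩
  have wf : WellFounded (fun a b : Tx => h.so b a = true) :=
    Finite.wellFounded_of_trans_of_irrefl _
  obtain ⟨s, hs, hmin⟩ := wf.has_min {s | m s ∧ (t = s ∨ h.so t s = true)} ⟨t, ht, Or.inl rfl⟩
  refine ⟨s, hs.1, fun s' hs' hlt => hmin s' ⟨hs', Or.inr ?_⟩ hlt, hs.2⟩
  rcases hs.2 with rfl | h2
  · exact hlt
  · exact hl.so_trans _ _ _ h2 hlt

/-- A set of transactions that is closed under predecessors is determined by its maximal elements,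
so there are at most `(|T| + 1) ^ width` of them. -/
theorem card_downClosed_le {h : History Key Row Tx Ev} (hl : OrderLaws h)
    (D : Finset (Tx → Bool))
    (hD : ∀ m ∈ D, ∀ s t, m t = true → h.so s t = true → m s = true) :
    D.card ≤ (Fintype.card Tx + 1) ^ h.width := by
  classical
  -- `g` sends a list of at most `width` transactions, padded with `none`, to its downward closure.
  -- The padding value is the `+ 1` in the bound.
  let g : (Fin h.width → Option Tx) → Tx → Bool := fun c t =>
    decide (∃ i s, c i = some s ∧ (t = s ∨ h.so t s = true))
  have hsub : D ⊆ Finset.univ.image g := by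
    intro m hm
    rw [Finset.mem_image]
    let A : Finset Tx := Finset.univ.filter fun t =>
      m t = true ∧ ∀ s, m s = true → ¬ h.so t s = true
    have hA : A.card ≤ h.width := h.card_le_width fun a ha b hb => by
      simp only [A, Finset.mem_filter, Finset.mem_univ, true_and] at ha hb
      exact ha.2 b hb.1
    -- The list of maximal elements of `m`; indices beyond its end give `none`, which is the
    -- padding.
    refine ⟨fun i => A.toList[(i : ℕ)]?, Finset.mem_univ _, ?_⟩
    funext t
    rw [Bool.eq_iff_iff, decide_eq_true_eq]
    constructor
    · rintro ⟨i, s, hi, hts⟩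
      have hs : s ∈ A := Finset.mem_toList.1 (List.mem_of_getElem? hi)
      simp only [A, Finset.mem_filter, Finset.mem_univ, true_and] at hs
      rcases hts with rfl | hts
      · exact hs.1
      · exact hD m hm _ _ hs.1 hts
    · intro ht
      obtain ⟨s, hs, hmax, hts⟩ := exists_maximal_above hl (fun t => m t = true) ht
      have hsA : s ∈ A.toList := by
        rw [Finset.mem_toList]
        simp only [A, Finset.mem_filter, Finset.mem_univ, true_and]
        exact ⟨hs, hmax⟩
      obtain ⟨i, hi, hi'⟩ := List.getElem_of_mem hsA
      rw [Finset.length_toList] at hi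
      exact ⟨⟨i, hi.trans_le hA⟩, s, by rw [List.getElem?_eq_some_iff]; exact ⟨_, hi'⟩, hts⟩
  calc D.card ≤ (Finset.univ.image g).card := Finset.card_le_card hsub
    _ ≤ (Finset.univ : Finset (Fin h.width → Option Tx)).card := Finset.card_image_le
    _ = _ := by simp

/-- The prefixes that the exploration reaches: `T_P` is closed under session predecessors, and
`M_P(x)` is a maximal element of the set of members of `T_P` that write `x`. -/
structure Reachable (h : History Key Row Tx Ev) (P : Committed Key Tx) : Prop where
  down : ∀ s t, P.mem t = true → h.so s t = true → P.mem s = true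
  last_none : ∀ x, P.last x = none → ∀ s, P.mem s = true →
    ¬ (buildTables h).val.writes s x = true
  last_some : ∀ x s, P.last x = some s → P.mem s = true ∧
    (buildTables h).val.writes s x = true ∧
    ∀ s', P.mem s' = true → (buildTables h).val.writes s' x = true → ¬ h.so s s' = true

theorem reachable_empty (h : History Key Row Tx Ev) :
    Reachable h (emptyCommitted : Timed (Committed Key Tx)).val where
  down _ _ ht := by cases ht
  last_none _ _ _ hs := by cases hs
  last_some _ _ hs := by cases hs

theorem extend_mem (h : History Key Row Tx Ev) (P : Committed Key Tx) (t s : Tx) :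
    (extend h P t).val.mem s = true ↔ P.mem s = true ∨ s = t := by
  change (P.mem s || decide (s = t)) = true ↔ _
  simp

theorem extend_last (h : History Key Row Tx Ev) (P : Committed Key Tx) (t : Tx) (x : Key) :
    (extend h P t).val.last x =
      if (buildTables h).val.writes t x then some t else P.last x := rfl

/-- The new transaction has no `so`-successor in `T_P`, since closure under predecessors would put
it into `T_P` already. Hence it is maximal in the new set and a legitimate last writer of its keys.
For a key it does not write, nothing changes. -/
theorem Reachable.extend {h : History Key Row Tx Ev} (hl : OrderLaws h) {P : Committed Key Tx}
    (hP : Reachable h P) {t : Tx} (ht : ¬ P.mem t = true)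
    (hs : ∀ s, h.so s t = true → P.mem s = true) : Reachable h (extend h P t).val where
  down s t' ht' hst := by
    rw [extend_mem] at ht' ⊢
    rcases ht' with ht' | rfl
    · exact Or.inl (hP.down _ _ ht' hst)
    · exact Or.inl (hs _ hst)
  last_none x hx s hmem := by
    rw [extend_last] at hx
    rw [extend_mem] at hmem
    split at hx
    · cases hx
    · rename_i hw
      rcases hmem with hmem | rfl
      · exact hP.last_none x hx s hmem
      · exact hw
  last_some x s hx := by
    rw [extend_last] at hx
    split at hx
    · rename_i hw
      cases hx
      refine ⟨(extend_mem _ _ _ _).2 (Or.inr rfl), hw, fun s' hs' _ hts => ?_⟩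
      rcases (extend_mem _ _ _ _).1 hs' with hs' | rfl
      · exact ht (hP.down _ _ hs' hts)
      · exact hl.so_irrefl _ hts
    · rename_i hw
      obtain ⟨h1, h2, h3⟩ := hP.last_some x s hx
      refine ⟨(extend_mem _ _ _ _).2 (Or.inl h1), h2, fun s' hs' hw' => ?_⟩
      rcases (extend_mem _ _ _ _).1 hs' with hs' | rfl
      · exact h3 s' hs' hw'
      · exact absurd hw' hw

theorem writes_init {h : History Key Row Tx Ev} (hl : OrderLaws h) (x : Key) :
    (buildTables h).val.writes h.init x = true := by
  obtain ⟨e, R, he, hk, hR⟩ := hl.init_insert x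
  obtain ⟨d, hd⟩ := Option.isSome_iff_exists.1 hR
  exact writes_of_txWrites hl
    ⟨e, he, ⟨d, .ins e R d hk hd⟩, by rw [he]; exact hl.init_not_aborted⟩

/-- A nonempty set closed under predecessors contains the initial transaction, which writes every
key. So "undefined" is not a further option for `M_P(x)`, and the count has `width` choices per key
instead of `width + 1`. -/
theorem Reachable.exists_last {h : History Key Row Tx Ev} (hl : OrderLaws h)
    {P : Committed Key Tx} (hP : Reachable h P) (hne : ∃ t, P.mem t = true) (x : Key) :
    ∃ s, P.last x = some s := by
  obtain ⟨t, ht⟩ := hne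
  have hi : P.mem h.init = true := by
    by_cases hti : t = h.init
    · rwa [← hti]
    · exact hP.down _ _ ht (hl.init_first t hti)
  cases hx : P.last x with
  | none => exact absurd (writes_init hl x) (hP.last_none x hx _ hi)
  | some s => exact ⟨s, rfl⟩

theorem encode_mem_injective (h : History Key Row Tx Ev) {P Q : Committed Key Tx}
    (hPQ : (encode h P).val = (encode h Q).val) : P.mem = Q.mem := by
  unfold encode at hPQ
  simp only [val_bind] at hPQ
  split at hPQ
  · rw [val_mapList, val_mapList, List.map_inj_left] at hPQ
    funext t
    exact hPQ (.inl t) (FinEnum.mem_toList _)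
  · rw [val_mapList, val_mapList, List.map_inj_left] at hPQ
    funext t
    exact hPQ t (FinEnum.mem_toList _)

theorem encode_eq_of_mem_eq {h : History Key Row Tx Ev} (hSI : ∀ t, h.iso t ≠ .SI)
    {P Q : Committed Key Tx} (hPQ : P.mem = Q.mem) : (encode h P).val = (encode h Q).val := by
  have : ¬ (anyOf fun t => op (decide (h.iso t = .SI))).val = true := by
    rw [val_anyOf]
    simpa using hSI
  unfold encode
  simp only [val_bind]
  rw [if_neg this, if_neg this, hPQ]

/-- A finite set of codes of nonempty reachable prefixes. -/
def CodeBound (h : History Key Row Tx Ev) (G : Finset (List Bool)) : Prop :=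
  ∀ P : Committed Key Tx, Reachable h P → (∃ t, P.mem t = true) → (encode h P).val ∈ G

theorem exists_codeBound_of_no_SI {h : History Key Row Tx Ev} (hl : OrderLaws h)
    (hSI : ∀ t, h.iso t ≠ .SI) :
    ∃ G, CodeBound h G ∧ G.card ≤ (Fintype.card Tx + 1) ^ h.width := by
  classical
  let D : Finset (Tx → Bool) := Finset.univ.filter fun m =>
    ∀ s t, m t = true → h.so s t = true → m s = true
  refine ⟨D.image fun m => (encode h ⟨m, fun _ => none⟩).val, ?_, ?_⟩
  · intro P hP _
    rw [Finset.mem_image]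
    exact ⟨P.mem, by simpa [D] using hP.down, encode_eq_of_mem_eq hSI rfl⟩
  · exact Finset.card_image_le.trans (card_downClosed_le hl D fun m hm => by simpa [D] using hm)

/-- For each set `T_P`, the map `M_P` lies in the product over the keys `x` of the sets `W m x` of
maximal writers of `x`. Each factor is an antichain. -/
theorem exists_codeBound {h : History Key Row Tx Ev} (hl : OrderLaws h) :
    ∃ G, CodeBound h G ∧
      G.card ≤ (Fintype.card Tx + 1) ^ h.width * h.width ^ Fintype.card Key := by
  classical
  let D : Finset (Tx → Bool) := Finset.univ.filter fun m =>
    ∀ s t, m t = true → h.so s t = true → m s = true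
  let W : (Tx → Bool) → Key → Finset Tx := fun m x => Finset.univ.filter fun t =>
    (m t = true ∧ (buildTables h).val.writes t x = true) ∧
      ∀ s, m s = true → (buildTables h).val.writes s x = true → ¬ h.so t s = true
  let F : (Tx → Bool) → Finset (List Bool) := fun m =>
    (Fintype.piFinset (W m)).image fun l => (encode h ⟨m, fun x => some (l x)⟩).val
  refine ⟨D.biUnion F, ?_, ?_⟩
  · intro P hP hne
    choose l hlast using hP.exists_last hl hne
    rw [Finset.mem_biUnion]
    refine ⟨P.mem, by simpa [D] using hP.down, ?_⟩
    rw [Finset.mem_image]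
    refine ⟨l, ?_, ?_⟩
    · rw [Fintype.mem_piFinset]
      intro x
      obtain ⟨h1, h2, h3⟩ := hP.last_some x _ (hlast x)
      simp only [W, Finset.mem_filter, Finset.mem_univ, true_and]
      exact ⟨⟨h1, h2⟩, h3⟩
    · have : (fun x => some (l x)) = P.last := funext fun x => (hlast x).symm
      rw [this]
  · refine (Finset.card_biUnion_le_card_mul D F (h.width ^ Fintype.card Key) ?_).trans
      (Nat.mul_le_mul_right _ (card_downClosed_le hl D fun m hm => by simpa [D] using hm))
    intro m _
    refine Finset.card_image_le.trans ?_
    rw [Fintype.card_piFinset]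
    refine (Finset.prod_le_pow_card _ _ h.width fun x _ => ?_).trans_eq (by simp)
    refine h.card_le_width fun a ha b hb => ?_
    simp only [W, Finset.mem_filter, Finset.mem_univ, true_and] at ha hb
    exact ha.2 b hb.1.1 hb.1.2

end History

namespace Timed

/-- Amortized running time of a loop: the body costs at most `B`, apart from an increase of the
potential `φ`, and apart from an amount `F` that is paid only when the loop is left. -/
theorem forUntil_amortized {α σ : Type} {body : α → σ → Timed (Bool × σ)} {φ : σ → ℕ}
    {rel : σ → σ → Prop} {B F : ℕ} (refl : ∀ s, rel s s)
    (trans : ∀ s₁ s₂ s₃, rel s₁ s₂ → rel s₂ s₃ → rel s₁ s₃)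
    (hb : ∀ a s, rel s (body a s).val.2 ∧
      (body a s).cost + φ s ≤ B + (body a s).val.1.toNat * F + φ (body a s).val.2)
    (l : List α) (s : σ) :
    rel s (forUntil body l s).val.2 ∧
      (forUntil body l s).cost + φ s ≤ 1 + l.length * (B + 2) +
        (forUntil body l s).val.1.toNat * F + φ (forUntil body l s).val.2 := by
  induction l generalizing s with
  | nil => exact ⟨refl s, by simp [forUntil]⟩
  | cons a l ih =>
    obtain ⟨h1, h2⟩ := hb a s
    simp only [forUntil, cost_bind, cost_op, val_op, val_bind, List.length_cons]
    by_cases hf : (body a s).val.1 = true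
    · rw [hf] at h2
      rw [if_pos hf]
      refine ⟨h1, ?_⟩
      simp only [val_op, cost_op]
      nlinarith [Nat.zero_le (l.length * (B + 2))]
    · rw [Bool.eq_false_of_not_eq_true hf] at h2
      rw [if_neg hf]
      obtain ⟨h3, h4⟩ := ih (body a s).val.2
      refine ⟨trans _ _ _ h1 h3, ?_⟩
      simp only [Bool.toNat_false, zero_mul] at h2
      linarith

end Timed

namespace History

variable {Key Row Tx Ev : Type} [FinEnum Key] [FinEnum Tx] [FinEnum Ev]

/-! ## Every reachable prefix is explored at most once, up to equivalence -/

/-- The number of elements of `G` in `seen`. -/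
noncomputable def numSeen (G : Finset (List Bool)) (seen : Trie) : ℕ :=
  (G.filter fun c => (seen.member c).val = true).card

theorem numSeen_insert {G : Finset (List Bool)} {seen : Trie} {c : List Bool} (hc : c ∈ G)
    (hs : ¬ (seen.member c).val = true) :
    numSeen G (seen.insert c).val = numSeen G seen + 1 := by
  classical
  unfold numSeen
  rw [← Finset.card_insert_of_notMem (s := G.filter fun c => (seen.member c).val = true) (a := c)
    (by simp [hs])]
  congr 1
  ext c'
  simp only [Finset.mem_filter, Trie.member_insert, Finset.mem_insert]
  constructor
  · rintro ⟨h1, h2 | h2⟩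
    · exact Or.inl h2
    · exact Or.inr ⟨h1, h2⟩
  · rintro (rfl | ⟨h1, h2⟩)
    · exact ⟨hc, Or.inl rfl⟩
    · exact ⟨h1, Or.inr h2⟩

/-- The number of transactions in a prefix. -/
def prefixCard (P : Committed Key Tx) : ℕ := (Finset.univ.filter fun t => P.mem t = true).card

theorem prefixCard_extend (h : History Key Row Tx Ev) {P : Committed Key Tx} {t : Tx}
    (ht : ¬ P.mem t = true) : prefixCard P < prefixCard (extend h P t).val := by
  refine Finset.card_lt_card (Finset.ssubset_iff_of_subset ?_ |>.2 ⟨t, ?_, ?_⟩)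
  · intro s hs
    simp only [Finset.mem_filter, Finset.mem_univ, true_and] at hs ⊢
    exact (extend_mem _ _ _ _).2 (Or.inl hs)
  · simp only [Finset.mem_filter, Finset.mem_univ, true_and]
    exact (extend_mem _ _ _ _).2 (Or.inr rfl)
  · simpa using ht

/-- All codes that are in `seen'` but not in `seen` belong to prefixes with more than `k`
transactions. -/
def NewAbove (h : History Key Row Tx Ev) (k : ℕ) (seen seen' : Trie) : Prop :=
  ∀ c, (seen'.member c).val = true → (seen.member c).val = true ∨
    ∃ Q : Committed Key Tx, (encode h Q).val = c ∧ k < prefixCard Q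

theorem NewAbove.refl (h : History Key Row Tx Ev) (k : ℕ) (seen : Trie) :
    NewAbove h k seen seen := fun _ hc => Or.inl hc

theorem NewAbove.trans {h : History Key Row Tx Ev} {k : ℕ} {s₁ s₂ s₃ : Trie}
    (h₁ : NewAbove h k s₁ s₂) (h₂ : NewAbove h k s₂ s₃) : NewAbove h k s₁ s₃ := fun c hc =>
  (h₂ c hc).elim (h₁ c) Or.inr

theorem NewAbove.mono {h : History Key Row Tx Ev} {k k' : ℕ} {s₁ s₂ : Trie} (hk : k ≤ k')
    (h₁ : NewAbove h k' s₁ s₂) : NewAbove h k s₁ s₂ := fun c hc =>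
  (h₁ c hc).imp_right fun ⟨Q, h1, h2⟩ => ⟨Q, h1, hk.trans_lt h2⟩

theorem NewAbove.insert {h : History Key Row Tx Ev} {k : ℕ} (seen : Trie)
    {Q : Committed Key Tx} (hk : k < prefixCard Q) :
    NewAbove h k seen (seen.insert (encode h Q).val).val := fun _ hc =>
  ((Trie.member_insert _ _ _).1 hc).elim (fun hc => Or.inr ⟨Q, hc.symm, hk⟩) Or.inl

/-- Let `K = 390 * n ^ (e + 6)`, a bound for the work of one call outside its recursive calls. The
potential is `K` times the number of codes of `G` in `seen`. A failed call costs `K` beyond the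
growth of the potential, and the caller recovers this `K` by inserting the code. A successful call
is not followed by an insertion, so each level of the chain of successful calls adds `K`; this is
the term `K * m`. -/
theorem cost_explore_amortized (test : ConflictTest) {h : History Key Row Tx Ev} {n e : ℕ}
    (hn : SizeBound Key Tx Ev n) (he : VisExponent h e) (hl : OrderLaws h)
    {G : Finset (List Bool)} (hG : CodeBound h G) (m : ℕ) {P : Committed Key Tx}
    (hP : Reachable h P) (seen : Trie) :
    NewAbove h (prefixCard P) seen (explore test h m P seen).val.2 ∧
      (explore test h m P seen).cost + 390 * n ^ (e + 6) * numSeen G seen ≤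
        390 * n ^ (e + 6) + (explore test h m P seen).val.1.toNat * (390 * n ^ (e + 6) * m) +
          390 * n ^ (e + 6) * numSeen G (explore test h m P seen).val.2 := by
  have p := hn.pos
  have q := he.pos
  induction m generalizing P seen with
  | zero =>
    have := one_le_cost (n := n) (C := 390) (k := e + 6) p (by norm_num)
    exact ⟨NewAbove.refl _ _ _, by simp only [explore, val_op, cost_op, Bool.toNat_false]; omega⟩
  | succ m ih =>
    have hfull := pow_mono_cost p (cost_allOf_le (C := 1) (k := 0) p hn.tx fun t : Tx =>
      (cost_op (P.mem t)).trans_le (by simp)) (C' := 3) (k' := e + 6) (by norm_num) (by omega)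
    have h1 := one_le_cost (n := n) (C := 1) (k := e + 6) p le_rfl
    simp only [explore, cost_bind, val_bind]
    by_cases hf : (allOf fun t => op (P.mem t)).val = true
    · rw [if_pos hf]
      refine ⟨NewAbove.refl _ _ _, ?_⟩
      simp only [val_op, cost_op]
      generalize true.toNat * _ = y
      omega
    · rw [if_neg hf]
      -- `B` covers the test, the extension, the encoding and the operations on `seen` for one
      -- candidate. `F` is the full cost `K + K * m` of a successful recursive call, which occurs at
      -- most once because it ends the loop.
      have key := forUntil_amortized (φ := fun s => 390 * n ^ (e + 6) * numSeen G s)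
        (rel := NewAbove h (prefixCard P)) (B := 380 * n ^ (e + 5))
        (F := 390 * n ^ (e + 6) * (m + 1))
        (body := fun t seen₁ =>
        if P.mem t then op (false, seen₁)
        else do
          let ok ← isConsistentExtension test h P t
          if !ok then op (false, seen₁)
          else do
            let Q ← extend h P t
            let code ← encode h Q
            let old ← seen₁.member code
            if old then op (false, seen₁)
            else do
              let res ← explore test h m Q seen₁
              if res.1 then op (true, res.2)
              else do
                let seen₃ ← res.2.insert code
                op (false, seen₃))
        (NewAbove.refl h _) (fun _ _ _ => NewAbove.trans) ?_ (FinEnum.toList Tx) seen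
      · refine ⟨key.1, ?_⟩
        have k2 := key.2
        rw [length_toList] at k2
        have hT : Fintype.card Tx * (380 * n ^ (e + 5) + 2) ≤ 382 * n ^ (e + 6) := by
          have h2 := one_le_cost (n := n) (C := 1) (k := e + 5) p le_rfl
          calc _ ≤ n * (382 * n ^ (e + 5)) := Nat.mul_le_mul hn.tx (by omega)
            _ = _ := by ring
        refine (Nat.add_assoc _ _ _).trans_le ((Nat.add_le_add hfull k2).trans ?_)
        omega
      · intro t s
        have h0 := cost_isConsistentExtension_le test hn he P t
        have h2 := pow_mono_cost p (cost_extend_le h hn P t) (C' := 47) (k' := e + 5) le_rfl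
          (by omega)
        have h3 := pow_mono_cost p (cost_encode_le h hn (extend h P t).val) (C' := 8)
          (k' := e + 5) le_rfl (by omega)
        have hlen := pow_mono_cost p (length_encode_le h hn (extend h P t).val) (C' := 2)
          (k' := e + 5) le_rfl (by omega)
        have h4 := Trie.cost_member_le s (encode h (extend h P t).val).val
        have h5 := one_le_cost (n := n) (C := 1) (k := e + 5) p le_rfl
        by_cases hPt : P.mem t = true
        · rw [if_pos hPt]
          refine ⟨NewAbove.refl _ _ _, ?_⟩
          simp only [val_op, cost_op, Bool.toNat_false]
          omega
        rw [if_neg hPt]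
        simp only [cost_bind, val_bind]
        by_cases hok : (isConsistentExtension test h P t).val = true
        swap
        · rw [if_pos (by simpa using hok)]
          refine ⟨NewAbove.refl _ _ _, ?_⟩
          simp only [val_op, cost_op, Bool.toNat_false]
          omega
        rw [if_neg (by simpa using hok)]
        simp only [cost_bind, val_bind]
        by_cases hold : (s.member (encode h (extend h P t).val).val).val = true
        · rw [if_pos hold]
          refine ⟨NewAbove.refl _ _ _, ?_⟩
          simp only [val_op, cost_op, Bool.toNat_false]
          omega
        rw [if_neg hold]
        have hQ := hP.extend hl hPt fun s hs => isConsistentExtension_so hok hs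
        have hlt := prefixCard_extend h hPt
        obtain ⟨h6, h7⟩ := ih hQ s
        simp only [cost_bind, val_bind]
        by_cases hfound : (explore test h m (extend h P t).val s).val.1 = true
        · rw [if_pos hfound]
          rw [hfound] at h7
          refine ⟨h6.mono hlt.le, ?_⟩
          simp only [val_op, cost_op, Bool.toNat_true, one_mul] at h7 ⊢
          rw [mul_add, mul_one]
          omega
        · rw [if_neg hfound]
          rw [Bool.eq_false_of_not_eq_true hfound] at h7
          refine ⟨(h6.mono hlt.le).trans (NewAbove.insert _ hlt), ?_⟩
          -- The recursive call has added only codes of prefixes with more transactions than the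
          -- present one. As a code determines `T_P`, the code inserted now is not among them, so
          -- the insertion raises the potential.
          have hnew : ¬ (((explore test h m (extend h P t).val s).val.2).member
              (encode h (extend h P t).val).val).val = true := by
            intro hmem
            rcases h6 _ hmem with hmem | ⟨Q', hQ', hlt'⟩
            · exact hold hmem
            · have := encode_mem_injective h hQ'
              unfold prefixCard at hlt'
              rw [this] at hlt'
              exact lt_irrefl _ hlt'
          have h8 := Trie.cost_insert_le (explore test h m (extend h P t).val s).val.2
            (encode h (extend h P t).val).val
          simp only [val_op, cost_op, val_bind, cost_bind, Bool.toNat_false, zero_mul] at h7 ⊢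
          rw [numSeen_insert (hG _ hQ ⟨t, (extend_mem _ _ _ _).2 (Or.inr rfl)⟩) hnew, mul_add,
            mul_one]
          omega

/-- Three amounts of at most `390 * n ^ (e + 6) * N` occur: the initial call, the chain of
successful calls of length `|T| + 1 ≤ n ≤ N`, and the final potential. -/
theorem cost_exploreFromEmpty_le (test : ConflictTest) {h : History Key Row Tx Ev} {n e N : ℕ}
    (hn : SizeBound Key Tx Ev n) (he : VisExponent h e) (hl : OrderLaws h)
    {G : Finset (List Bool)} (hG : CodeBound h G) (hGN : G.card ≤ N) (hN : n ≤ N)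
    (hT : Fintype.card Tx + 1 ≤ n) :
    (exploreFromEmpty test h).cost ≤ 1180 * (n ^ (e + 6) * N) := by
  have p := hn.pos
  unfold exploreFromEmpty
  simp only [cost_bind, cost_op]
  have h0 := cost_emptyCommitted_le hn
  have h1 := (cost_explore_amortized test hn he hl hG (Fintype.card Tx + 1)
    (reachable_empty h) .leaf).2
  set r := explore test h (Fintype.card Tx + 1) (emptyCommitted : Timed (Committed Key Tx)).val
    .leaf
  have h2 : numSeen G r.val.2 ≤ N := (Finset.card_filter_le _ _).trans hGN
  have h3 : r.val.1.toNat ≤ 1 := Bool.toNat_le _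
  have h4 : r.val.1.toNat * (390 * n ^ (e + 6) * (Fintype.card Tx + 1)) ≤
      390 * (n ^ (e + 6) * N) := by
    calc _ ≤ 1 * (390 * n ^ (e + 6) * N) := by gcongr; omega
      _ = _ := by ring
  have h5 : 390 * n ^ (e + 6) * numSeen G r.val.2 ≤ 390 * (n ^ (e + 6) * N) := by
    rw [mul_assoc]; gcongr
  have h6 : n ^ (e + 6) ≤ n ^ (e + 6) * N := Nat.le_mul_of_pos_right _ (by omega)
  have h7 : n ≤ n ^ (e + 6) * N := hN.trans (Nat.le_mul_of_pos_left _ (by positivity))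
  omega

end History

namespace History

variable {Key Row Tx Ev : Type} [FinEnum Key] [FinEnum Tx] [FinEnum Ev]

/-! ## The running time of the whole algorithm -/

theorem length_forEach_cons {α β : Type} (g : α → β) (l : List α) (acc : List β) :
    (forEach (fun a acc => op (g a :: acc)) l acc).val.length = l.length + acc.length := by
  induction l generalizing acc with
  | nil => simp [forEach]
  | cons a l ih =>
    simp only [forEach, val_bind, val_op, ih, List.length_cons]
    omega

theorem length_choices_step (p : Ev × Key) (ts : List Tx) (fs acc : List (List ((Ev × Key) × Tx))) :
    (forEach (fun t acc => forEach (fun f acc' => op (((p, t) :: f) :: acc')) fs acc)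
      ts acc).val.length = ts.length * fs.length + acc.length := by
  induction ts generalizing acc with
  | nil => simp [forEach]
  | cons t ts ih =>
    simp only [forEach, val_bind, val_op, ih, length_forEach_cons, List.length_cons]
    ring

theorem length_choices_le {n : ℕ} (l : List ((Ev × Key) × List Tx))
    (hl : ∀ z ∈ l, z.2.length ≤ n) : (choices l).val.length ≤ n ^ l.length := by
  induction l with
  | nil => simp [choices]
  | cons z l ih =>
    obtain ⟨p, ts⟩ := z
    simp only [choices, val_bind, length_choices_step, List.length_cons, List.length_nil, add_zero]
    rw [pow_succ']
    exact Nat.mul_le_mul (hl _ List.mem_cons_self)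
      (ih fun z hz => hl z (List.mem_cons_of_mem _ hz))

theorem length_of_mem_choices (l : List ((Ev × Key) × List Tx)) :
    ∀ f ∈ (choices l).val, f.length = l.length := by
  induction l with
  | nil => simp [choices]
  | cons z l ih =>
    obtain ⟨p, ts⟩ := z
    simp only [choices, val_bind]
    generalize hfs : (choices l).val = fs at ih
    have inner : ∀ (t : Tx) (fs' : List (List ((Ev × Key) × Tx))) (acc : List _),
        (∀ f ∈ fs', f.length = l.length) → (∀ f ∈ acc, f.length = l.length + 1) →
        ∀ f ∈ (forEach (fun f acc' => op (((p, t) :: f) :: acc')) fs' acc).val,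
          f.length = l.length + 1 := by
      intro t fs'
      induction fs' with
      | nil => intro acc _ hacc; exact hacc
      | cons g fs' ih' =>
        intro acc hfs' hacc
        refine ih' _ (fun f hf => hfs' f (List.mem_cons_of_mem _ hf)) ?_
        intro f hf
        rcases List.mem_cons.1 hf with rfl | hf
        · simp [hfs' g List.mem_cons_self]
        · exact hacc f hf
    exact forEach_keep (p := fun acc : List (List ((Ev × Key) × Tx)) =>
      ∀ f ∈ acc, f.length = l.length + 1) (fun t acc hacc => inner t fs acc ih hacc) ts []
      (by simp)

/-- Each further conflict multiplies the number of mappings by at most `n`. The costs of the stages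
form a geometric series, and `n ≥ 2` bounds it by a multiple of its last term, without a factor for
the number of conflicts. -/
theorem cost_choices_le {n : ℕ} (hn : 2 ≤ n) (l : List ((Ev × Key) × List Tx))
    (hl : ∀ z ∈ l, z.2.length ≤ n) : (choices l).cost ≤ 10 * n ^ l.length := by
  induction l with
  | nil => simp [choices]
  | cons z l ih =>
    obtain ⟨p, ts⟩ := z
    have hl' : ∀ z ∈ l, z.2.length ≤ n := fun z hz => hl z (List.mem_cons_of_mem _ hz)
    have h1 := ih hl'
    have h2 := length_choices_le l hl'
    have h3 : ts.length ≤ n := hl _ List.mem_cons_self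
    simp only [choices, cost_bind, List.length_cons]
    have h4 := cost_forEach_le' (body := fun (t : Tx) acc =>
      forEach (fun f acc' => op (((p, t) :: f) :: acc')) (choices l).val acc)
      (c := 1 + 2 * n ^ l.length) (l := ts) (fun t _ acc =>
        (cost_forEach_le' (c := 1) (fun f _ acc' => le_rfl) acc).trans (by omega)) []
    have h5 : 1 ≤ n ^ l.length := Nat.one_le_pow _ _ (by omega)
    have h6 : ts.length * (1 + 2 * n ^ l.length + 1) ≤ n * (4 * n ^ l.length) :=
      Nat.mul_le_mul h3 (by omega)
    have h7 : 2 * n ^ l.length ≤ n * n ^ l.length := Nat.mul_le_mul_right _ hn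
    rw [pow_succ']
    nlinarith

theorem cost_addReads_le (h : History Key Row Tx Ev) {n : ℕ} (hn : SizeBound Key Tx Ev n)
    (f : List ((Ev × Key) × Tx)) (hf : f.length ≤ n ^ 2) : (addReads h f).cost ≤ 50 * n ^ 4 := by
  have p := hn.pos
  unfold addReads
  simp only [cost_bind, cost_op]
  have h1 := cost_buildTables_le h hn
  have h2 := pow_mono_cost p (cost_tabulate_le p hn.key fun x : Key =>
    cost_tabulate_le (C := 1) (k := 0) p hn.ev fun r : Ev =>
      (cost_op (h.wrInv x r)).trans_le (by simp)) (C' := 5) (k' := 4) (by norm_num) (by omega)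
  have h3 := cost_forEach_le' (body := fun (c : (Ev × Key) × Tx) (s : Key → Ev → Option Ev) =>
      op fun x r => if x = c.1.2 ∧ r = c.1.1 then
        ((buildTables h).val.last c.2 x).map Prod.fst else s x r) (c := 1) (l := f)
      (fun _ _ _ => le_rfl) (tabulate fun x => tabulate fun r => op (h.wrInv x r)).val
  have h4 := one_le_cost (n := n) (C := 1) (k := 4) p le_rfl
  have h5 : n ^ 2 ≤ n ^ 4 := Nat.pow_le_pow_right p (by norm_num)
  omega

theorem addReads_val (h : History Key Row Tx Ev) (f : List ((Ev × Key) × Tx)) :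
    ∃ s, (addReads h f).val = { h with wrInv := s } := ⟨_, rfl⟩

theorem length_toList_reads_le {n : ℕ} (hn : SizeBound Key Tx Ev n) :
    (FinEnum.toList (Ev × Key)).length ≤ n ^ 2 := by
  rw [length_toList, Fintype.card_eq_nat_card, Nat.card_prod, Nat.card_eq_fintype_card,
    Nat.card_eq_fintype_card, sq]
  exact Nat.mul_le_mul hn.ev hn.key

/-- The algorithm finds at most `#conf(h)` conflicts. -/
theorem length_conflicts_le {h : History Key Row Tx Ev} (hl : OrderLaws h) :
    (filterOf fun (p : Ev × Key) =>
      if (h.kind p.1).isRead && (h.wrInv p.2 p.1).isNone then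
        anyOf fun t => op (!(computePco h).val (h.tr p.1) t &&
          ((buildTables h).val.last t p.2).any fun d => d.2.sat (h.kind p.1).whereP)
      else op false).val.length ≤ h.numConf := by
  classical
  rw [val_filterOf, ← List.toFinset_card_of_nodup (FinEnum.nodup_toList.filter _),
    ← Set.ncard_coe_finset]
  refine Set.ncard_le_ncard ?_ (Set.toFinite _)
  intro p hp
  rw [List.coe_toFinset, Set.mem_ofPred_eq, List.mem_filter] at hp
  obtain ⟨-, hp⟩ := hp
  split at hp
  · rename_i hc
    rw [Bool.and_eq_true, Option.isNone_iff_eq_none] at hc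
    rw [val_anyOf] at hp
    obtain ⟨t, ht⟩ := hp
    rw [val_op, Bool.and_eq_true, Bool.not_eq_true', Option.any_eq_true] at ht
    obtain ⟨h1, ⟨w, d⟩, h2, h3⟩ := ht
    -- A pair outside the computed relation is outside `Pco`, so a transaction that passes the
    -- program's test belongs to `OneSet`.
    refine ⟨hc.1, hc.2, t, fun hpco => ?_, d, txValue_of_last hl h2, h3⟩
    rw [computePco_of_pco hl hpco] at h1
    cases h1
  · cases hp

/-- `N` has to bound the codes for every `wrInv`, because the exploration is run on each history
made by `addReads`. There are at most `n ^ #conf` of these, and the loop over them dominates the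
computation of `pco`, `E_h` and `X_h`. -/
theorem cost_checkConsistency_le (test : ConflictTest) {h : History Key Row Tx Ev}
    (hh : h.IsHistory) {n e N : ℕ} (hn : SizeBound Key Tx Ev n) (he : VisExponent h e)
    (hT : Fintype.card Tx + 1 ≤ n) (hN : n ≤ N)
    (hG : ∀ s, ∃ G, CodeBound { h with wrInv := s } G ∧ G.card ≤ N) :
    (h.checkConsistency test).cost ≤ 1600 * (n ^ h.numConf * (n ^ (e + 6) * N)) := by
  have p := hn.pos
  have q := he.pos
  have hl : OrderLaws h := hh.orderLaws h.wrInv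
  have hexp : ∀ s, (exploreFromEmpty test { h with wrInv := s }).cost ≤
      1180 * (n ^ (e + 6) * N) := by
    intro s
    obtain ⟨G, h1, h2⟩ := hG s
    exact cost_exploreFromEmpty_le test hn ⟨he.pos, he.two_le⟩ (hh.orderLaws s) h1 h2 hN hT
  -- With `|T| + 1 ≤ n` this gives the `2 ≤ n` that `cost_choices_le` requires.
  have hT1 : 1 ≤ Fintype.card Tx := Fintype.card_pos_iff.2 ⟨h.init⟩
  unfold checkConsistency
  simp only [cost_bind]
  have hElen := length_conflicts_le hl
  have hElen' : (filterOf fun (p : Ev × Key) =>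
      if (h.kind p.1).isRead && (h.wrInv p.2 p.1).isNone then
        anyOf fun t => op (!(computePco h).val (h.tr p.1) t &&
          ((buildTables h).val.last t p.2).any fun d => d.2.sat (h.kind p.1).whereP)
      else op false).val.length ≤ n ^ 2 :=
    (List.length_filter_le _ _).trans (length_toList_reads_le hn)
  have hEcost : (filterOf fun (p : Ev × Key) =>
      if (h.kind p.1).isRead && (h.wrInv p.2 p.1).isNone then
        anyOf fun t => op (!(computePco h).val (h.tr p.1) t &&
          ((buildTables h).val.last t p.2).any fun d => d.2.sat (h.kind p.1).whereP)
      else op false).cost ≤ 5 * n ^ 3 := by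
    refine (cost_filterOf_le' (c := 3 * n) fun r => ?_).trans ?_
    · split
      · exact (cost_anyOf_le (C := 1) (k := 0) p hn.tx fun t =>
          (cost_op _).trans_le (by simp)).trans (by simp)
      · simp only [cost_op]; omega
    · have h1 := Nat.mul_le_mul_right (3 * n + 1) (length_toList_reads_le hn)
      have h2 : n ^ 2 * (3 * n + 1) ≤ n ^ 2 * (4 * n) := Nat.mul_le_mul_left _ (by omega)
      have h3 := one_le_cost (n := n) (C := 1) (k := 3) p le_rfl
      have h4 : n ^ 2 * (4 * n) = 4 * n ^ 3 := by ring
      omega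
  set E := filterOf fun (p : Ev × Key) =>
      if (h.kind p.1).isRead && (h.wrInv p.2 p.1).isNone then
        anyOf fun t => op (!(computePco h).val (h.tr p.1) t &&
          ((buildTables h).val.last t p.2).any fun d => d.2.sat (h.kind p.1).whereP)
      else op false
  have hZcost : (mapList (fun (p : Ev × Key) => do
      let ts ← filterOf fun (t : Tx) => op (!(computePco h).val (h.tr p.1) t &&
        ((buildTables h).val.last t p.2).any fun d => !d.2.sat (h.kind p.1).whereP)
      op (p, ts)) E.val).cost ≤ 6 * n ^ 3 := by
    refine (cost_mapList_le' (c := 4 * n) fun r _ => ?_).trans ?_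
    · simp only [cost_bind, cost_op]
      have := cost_filterOf_le (C := 1) (k := 0) p hn.tx fun t : Tx =>
        (cost_op (!(computePco h).val (h.tr r.1) t &&
          ((buildTables h).val.last t r.2).any fun d =>
            !d.2.sat (h.kind r.1).whereP)).trans_le (by simp)
      simp only [zero_add, pow_one] at this
      omega
    · have h1 := Nat.mul_le_mul_right (4 * n + 1) hElen'
      have h2 : n ^ 2 * (4 * n + 1) ≤ n ^ 2 * (5 * n) := Nat.mul_le_mul_left _ (by omega)
      have h3 := one_le_cost (n := n) (C := 1) (k := 3) p le_rfl
      have h4 : n ^ 2 * (5 * n) = 5 * n ^ 3 := by ring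
      omega
  have hZval := val_mapList (fun (p : Ev × Key) => do
      let ts ← filterOf fun (t : Tx) => op (!(computePco h).val (h.tr p.1) t &&
        ((buildTables h).val.last t p.2).any fun d => !d.2.sat (h.kind p.1).whereP)
      op (p, ts)) E.val
  set Z := mapList (fun (p : Ev × Key) => do
      let ts ← filterOf fun (t : Tx) => op (!(computePco h).val (h.tr p.1) t &&
        ((buildTables h).val.last t p.2).any fun d => !d.2.sat (h.kind p.1).whereP)
      op (p, ts)) E.val
  have hZlen : Z.val.length = E.val.length := by rw [hZval, List.length_map]
  have hZts : ∀ z ∈ Z.val, z.2.length ≤ n := by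
    intro z hz
    rw [hZval, List.mem_map] at hz
    obtain ⟨r, -, rfl⟩ := hz
    exact ((List.length_filter_le _ _).trans_eq length_toList).trans hn.tx
  have hXlen := length_choices_le Z.val hZts
  have hXcost := cost_choices_le (by omega) Z.val hZts
  have hXmem := length_of_mem_choices Z.val
  rw [hZlen] at hXlen hXcost hXmem
  have hmE : n ^ E.val.length ≤ n ^ h.numConf := Nat.pow_le_pow_right p hElen
  set M := n ^ h.numConf
  have hM : 1 ≤ M := Nat.one_le_pow _ _ p
  set A := n ^ (e + 6) * N
  have hA : ∀ k ≤ e + 6, n ^ k ≤ A := fun k hk =>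
    (Nat.pow_le_pow_right p hk).trans (Nat.le_mul_of_pos_right _ (by omega))
  have hMA : A ≤ M * A := Nat.le_mul_of_pos_left _ hM
  have hA1 : 1 ≤ A := hA 0 (by omega)
  have hMM : M ≤ M * A := Nat.le_mul_of_pos_right _ hA1
  have c1 := cost_computePco_le hn he
  have c2 := cost_buildTables_le h hn
  have c3 := cost_isCyclic_le (computePco h).val hn
  have c4 : (forEach (fun (z : (Ev × Key) × List Tx) b => op (b || z.2.isEmpty)) Z.val
      false).cost ≤ 1 + 2 * n ^ 2 := by
    refine (cost_forEach_le' (c := 1) (fun _ _ _ => le_rfl) _).trans ?_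
    omega
  have a1 := hA (e + 5) (by omega)
  have a2 := hA 4 (by omega)
  have a3 := hA 3 (by omega)
  have a4 := hA 2 (by omega)
  have rest : (if (isCyclic (computePco h).val).val = true then op false
      else do
        let stuck ← forEach (fun z b => op (b || z.2.isEmpty)) Z.val false
        if stuck = true then op false
          else if E.val.isEmpty = true then exploreFromEmpty test h
          else do
            let res ← forUntil (fun f (u : Unit) => do
              let h' ← addReads h f
              let b ← exploreFromEmpty test h'
              op (b, u)) (choices Z.val).val ()
            op res.1).cost ≤ 1300 * (M * A) := by
    split
    · simp only [cost_op]; omega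
    · simp only [cost_bind]
      split
      · simp only [cost_op]; omega
      · split
        · have := hexp h.wrInv
          have : (exploreFromEmpty test h).cost ≤ 1180 * A := this
          omega
        · simp only [cost_bind, cost_op]
          have hloop := cost_forUntil_le (body := fun f (u : Unit) => do
              let h' ← addReads h f
              let b ← exploreFromEmpty test h'
              op (b, u)) (c := 1231 * A) (l := (choices Z.val).val) (fun f hf u => by
                simp only [cost_bind, cost_op]
                obtain ⟨s, hs⟩ := addReads_val h f
                have := cost_addReads_le h hn f ((hXmem f hf).trans_le hElen')
                have := hexp s
                rw [hs]
                omega) ()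
          have hlen : (choices Z.val).val.length * (1231 * A + 2) ≤ M * (1233 * A) :=
            Nat.mul_le_mul (hXlen.trans hmE) (by omega)
          have : M * (1233 * A) = 1233 * (M * A) := by ring
          omega
  omega

/-- Some transaction has a `begin` event, so the events contribute at least one to the size. This
absorbs the `+ 1` in the base of the bound on prefixes. -/
theorem IsHistory.card_tx_lt_size {h : History Key Row Tx Ev} (hh : h.IsHistory) :
    Fintype.card Tx + 1 ≤ h.size := by
  obtain ⟨e, -⟩ := hh.begin_first h.init
  have : 1 ≤ Fintype.card Ev := Fintype.card_pos_iff.2 ⟨e⟩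
  unfold size
  omega

theorem IsHistory.sizeBound {h : History Key Row Tx Ev} (hh : h.IsHistory) :
    SizeBound Key Tx Ev h.size := by
  have := hh.card_tx_lt_size
  constructor <;> unfold size at * <;> omega

theorem cost_checkConsistency_le_of_isHistory (test : ConflictTest) {h : History Key Row Tx Ev}
    (hh : h.IsHistory) : (h.checkConsistency test).cost ≤
      1600 * (h.size ^ (h.numConf + h.width + 9) * h.width ^ Fintype.card Key) := by
  have hn := hh.sizeBound
  have hw := one_le_width (hh.orderLaws h.wrInv)
  have hw : 1 ≤ h.width := hw
  have hN : h.size ≤ h.size ^ h.width * h.width ^ Fintype.card Key :=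
    (Nat.le_self_pow (by omega) _).trans (Nat.le_mul_of_pos_right _ (Nat.pow_pos hw))
  refine (cost_checkConsistency_le test hh (e := 2) hn ⟨by norm_num, fun _ _ => le_rfl⟩
    hh.card_tx_lt_size hN fun s => ?_).trans ?_
  · obtain ⟨G, h1, h2⟩ := exists_codeBound (hh.orderLaws s)
    exact ⟨G, h1, h2.trans (Nat.mul_le_mul_right _ (Nat.pow_le_pow_left hh.card_tx_lt_size _))⟩
  · refine Nat.mul_le_mul_left _ ?_
    -- With `e = 2` the exponent `e + 6` is `8`, so one factor of the size is to spare.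
    calc _ = h.size ^ (h.numConf + h.width + 8) * h.width ^ Fintype.card Key := by ring
      _ ≤ _ := Nat.mul_le_mul_right _ (Nat.pow_le_pow_right hn.pos (by omega))

theorem cost_checkConsistency_le_of_no_SI (test : ConflictTest) {h : History Key Row Tx Ev}
    (hh : h.IsHistory) (hSI : ∀ t, h.iso t ≠ .SI) : (h.checkConsistency test).cost ≤
      1600 * h.size ^ (h.numConf + h.width + 8) := by
  have hn := hh.sizeBound
  have hw := one_le_width (hh.orderLaws h.wrInv)
  have hw : 1 ≤ h.width := hw
  refine (cost_checkConsistency_le test hh (e := 1) hn ⟨le_rfl, fun t ht => absurd ht (hSI t)⟩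
    hh.card_tx_lt_size (N := h.size ^ h.width) (Nat.le_self_pow (by omega) _) fun s => ?_).trans ?_
  · obtain ⟨G, h1, h2⟩ := exists_codeBound_of_no_SI (hh.orderLaws s) hSI
    exact ⟨G, h1, h2.trans (Nat.pow_le_pow_left hh.card_tx_lt_size _)⟩
  · refine Nat.mul_le_mul_left _ ?_
    -- With `e = 1` the exponent `e + 6` is `7`, again with one factor to spare.
    calc _ = h.size ^ (h.numConf + h.width + 7) := by ring
      _ ≤ _ := Nat.pow_le_pow_right hn.pos (by omega)

end History

end MixedIso

/-! ### The three statements of the theorem. -/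

theorem theorem6 (test : MixedIso.History.ConflictTest) :
    (∃ C : ℕ, ∀ (Key Row Tx Ev : Type) [FinEnum Key] [FinEnum Tx] [FinEnum Ev]
      (h : MixedIso.History Key Row Tx Ev), h.IsClient →
        (h.checkConsistency test).cost ≤
          C * (h.size ^ (h.numConf + h.width + 9) * h.width ^ Fintype.card Key)) ∧
    (∃ C : ℕ, ∀ (Key Row Tx Ev : Type) [FinEnum Key] [FinEnum Tx] [FinEnum Ev]
      (h : MixedIso.History Key Row Tx Ev), h.IsClient →
        (∀ t, h.iso t ≠ MixedIso.IsoLevel.SI) →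
        (h.checkConsistency test).cost ≤ C * h.size ^ (h.numConf + h.width + 8)) ∧
    (∀ b : ℕ, ∃ p : Polynomial ℕ, ∀ (Key Row Tx Ev : Type) [FinEnum Key] [FinEnum Tx]
      [FinEnum Ev] (h : MixedIso.History Key Row Tx Ev), h.IsClient →
        (∀ t, h.iso t ≠ MixedIso.IsoLevel.SI) → h.numConf = 0 → h.width ≤ b →
        (h.checkConsistency test).cost ≤ p.eval h.size) := by
  refine ⟨⟨1600, fun _ _ _ _ _ _ _ h hh =>
      h.cost_checkConsistency_le_of_isHistory test hh.1⟩,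
    ⟨1600, fun _ _ _ _ _ _ _ h hh hSI => h.cost_checkConsistency_le_of_no_SI test hh.1 hSI⟩,
    fun b => ⟨Polynomial.C 1600 * Polynomial.X ^ (b + 8), fun _ _ _ _ _ _ _ h hh hSI h0 hb => ?_⟩⟩
  refine (h.cost_checkConsistency_le_of_no_SI test hh.1 hSI).trans ?_
  rw [Polynomial.eval_mul, Polynomial.eval_C, Polynomial.eval_pow, Polynomial.eval_X, h0, zero_add]
  exact Nat.mul_le_mul_left _ (Nat.pow_le_pow_right hh.1.sizeBound.pos (by omega))
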